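/- **Conventions.** An *effect algebra* is a partial commutative monoid $(E,0,\ovee)$ with a map $(-)^\perp$ such that $x^\perp$ is the unique element with $x\ovee x^\perp=1:=0^\perp$, and such that $x\ovee 1$ is defined only for $x=0$. Write $x\perp y$ if $x\ovee y$ is defined, and $x\le y$ if $x\ovee z=y$ for some $z$. An *effect module* is an effect algebra with a scalar multiplication by $[0,1]$ satisfying $1x=x$, $(rs)x=r(sx)$, $(r+s)x=rx\ovee sx$ if $r+s\le 1$, and $r(x\ovee y)=rx\ovee ry$ if $x\perp y$. Homomorphisms preserve $1$, scalars and existing sums; the category is $\mathbf{EMod}$. The sets $[0,1]$ and $[0,1]^X$ are effect modules with $r\ovee s=r+s$ (defined if $r+s\le1$), resp. pointwise. An effect module is *Archimedean* if $x\le y$ whenever $\frac12x\le\frac12y\ovee\frac r2 1$ for all $r\in(0,1]$. It is *Banach* if it is Archimedean and complete for the metric $$d(x,y)=\max\big(\inf\{r\in(0,1]\mid \tfrac12x\le\tfrac12y\ovee\tfrac r21\},\ \inf\{r\in(0,1]\mid \tfrac12y\le\tfrac12x\ovee\tfrac r21\}\big).$$ $\mathbf{BEMod}\subseteq\mathbf{EMod}$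 is the full subcategory of Banach effect modules. The *expectation monad* $\mathcal E$ on sets is $\mathcal E(X)=\mathbf{EMod}([0,1]^X,[0,1])$, $\mathcal E(f)(h)(p)=h(p\circ f)$, with unit $\eta(x)(p)=p(x)$ and multiplication $\mu(h)(p)=h(k\mapsto k(p))$. $\mathrm{Alg}(\mathcal E)$ is its category of Eilenberg–Moore algebras; $[0,1]$ is an algebra via $h\mapsto h(\mathrm{id})$. A *convex compact Hausdorff space* is a set with a compact Hausdorff topology and a convex structure (an algebra of the monad of finitely supported probability distributions). With affine continuous maps these form the category $\mathbf{CCH}$. Such a space $X$ is *observable* if $x=x'$ whenever $q(x)=q(x')$ for all affine continuous $q:X\to[0,1]$; $\mathbf{CCH}_{\mathrm{obs}}\subseteq\mathbf{CCH}$ is the full subcategory of observable spaces. An algebra $\alpha:\mathcal E(X)\to X$ makes $X$ a convex compact Hausdorff space: the convex combination $\sum_i r_ix_i$ is $\alpha\big(p\mapsto\sum_i r_ip(x_i)\big)$, and $U\subseteq X$ is closed iff $\alpha\big(p\mapsto\lim_{\mathcal F}p\big)\in U$ for every ultrafilter $\mathcal F$ on $X$ with $U\in\mathcal F$. This gives a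 functor $K:\mathrm{Alg}(\mathcal E)\to\mathbf{CCH}$ that is the identity on underlying sets and functions. The algebra is *observable* if $K(X)$ is; $\mathrm{Alg}_{\mathrm{obs}}(\mathcal E)\subseteq\mathrm{Alg}(\mathcal E)$ is the full subcategory of observable algebras. There is an adjunction $P\dashv S$ between $P=\mathrm{Alg}(\mathcal E)(-,[0,1]):\mathrm{Alg}(\mathcal E)\to\mathbf{EMod}^{\mathrm{op}}$ (pointwise effect module structure) and $S=\mathbf{EMod}(-,[0,1]):\mathbf{EMod}^{\mathrm{op}}\to\mathrm{Alg}(\mathcal E)$ (algebra structure $\alpha_M(h)(y)=h(k\mapsto k(y))$ on $\mathbf{EMod}(M,[0,1])$), whose unit and counit are given by evaluation, $x\mapsto(q\mapsto q(x))$ and $y\mapsto(k\mapsto k(y))$. **Theorem.** 1. The functor $P$ maps observable algebras to Banach effect modules, $S$ maps Banach effect modules to observable algebras, and the adjunction restricted to these full subcategories is an equivalence of categories (its unit and counit are isomorphisms) $$\mathrm{Alg}_{\mathrm{obs}}(\mathcal E)\ \simeq\ \mathbf{BEMod}^{\mathrm{op}}.$$ 2. The functor $K$ restricts to an isomorphism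 of categories $\mathrm{Alg}_{\mathrm{obs}}(\mathcal E)\cong\mathbf{CCH}_{\mathrm{obs}}$. Hence $\mathbf{CCH}_{\mathrm{obs}}\cong\mathrm{Alg}_{\mathrm{obs}}(\mathcal E)\simeq\mathbf{BEMod}^{\mathrm{op}}$. -/

import Mathlib

open CategoryTheory Opposite Filter Topology
open scoped unitInterval
open Convexity (StdSimplex ConvexSpace IsAffineMap)

universe u v w

/-! ### Effect algebras and effect modules -/

/-- An effect algebra: a partial commutative monoid `(zero, oplus)` with an orthosupplement
`compl`.  The sum `oplus x y` exists precisely when `Orth x y`; the top element is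
`compl zero`. -/
class EffectAlgebra (E : Type u) where
  /-- `Orth x y`: the sum of `x` and `y` is defined. -/
  Orth : E → E → Prop
  /-- The partial sum. -/
  oplus : ∀ x y : E, Orth x y → E
  /-- The bottom element. -/
  zero : E
  /-- The orthosupplement. -/
  compl : E → E
  orth_symm : ∀ {x y : E}, Orth x y → Orth y x
  oplus_comm : ∀ (x y : E) (h : Orth x y), oplus x y h = oplus y x (orth_symm h)
  oplus_assoc : ∀ (x y z : E) (hyz : Orth y z) (hx : Orth x (oplus y z hyz)),
    ∃ (hxy : Orth x y) (hz : Orth (oplus x y hxy) z),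
      oplus x (oplus y z hyz) hx = oplus (oplus x y hxy) z hz
  zero_orth : ∀ x : E, Orth zero x
  zero_oplus : ∀ x : E, oplus zero x (zero_orth x) = x
  orth_compl : ∀ x : E, Orth x (compl x)
  oplus_compl : ∀ x : E, oplus x (compl x) (orth_compl x) = compl zero
  eq_compl : ∀ (x y : E) (h : Orth x y), oplus x y h = compl zero → y = compl x
  eq_zero : ∀ x : E, Orth x (compl zero) → x = zero

namespace EffectAlgebra

/-- The top element of an effect algebra. -/
def one {E : Type u} [EffectAlgebra E] : E := compl zero

theorem zero_eq_compl_one {E : Type u} [EffectAlgebra E] : (zero : E) = compl one :=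
  eq_compl _ _ (orth_symm (zero_orth one)) ((oplus_comm _ _ _).trans (zero_oplus one))

/-- The order of an effect algebra: `x ≤ y` iff `x ⊕ z = y` for some `z`. -/
def Le {E : Type u} [EffectAlgebra E] (x y : E) : Prop :=
  ∃ (z : E) (h : Orth x z), oplus x z h = y

/-- The unit interval: `r ⊕ s = r + s`, defined when `r + s ≤ 1`, and `rᗮ = 1 - r`. -/
instance instUnitInterval : EffectAlgebra I where
  Orth r s := (r : ℝ) + s ≤ 1
  oplus r s h := ⟨r + s, add_nonneg r.2.1 s.2.1, h⟩
  zero := 0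
  compl := unitInterval.symm
  orth_symm h := by rwa [add_comm]
  oplus_comm r s h := Subtype.ext (add_comm _ _)
  oplus_assoc r s t hst hr :=
    ⟨by have := t.2.1; dsimp at hr; linarith, by dsimp at hr ⊢; linarith,
      Subtype.ext (add_assoc _ _ _).symm⟩
  zero_orth r := by simpa using r.2.2
  zero_oplus r := Subtype.ext (by simp)
  orth_compl r := by simp
  oplus_compl r := Subtype.ext (by simp)
  eq_compl r s h e := by
    have := congrArg Subtype.val e
    apply Subtype.ext
    simp at this ⊢
    linarith
  eq_zero r h := by
    apply Subtype.ext
    have := r.2.1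
    simp only [unitInterval.coe_symm_eq, Set.Icc.coe_zero] at h ⊢
    linarith

/-- Functions into an effect algebra, with the pointwise structure. -/
instance instPi {X : Type v} {E : Type u} [EffectAlgebra E] : EffectAlgebra (X → E) where
  Orth f g := ∀ x, Orth (f x) (g x)
  oplus f g h := fun x => oplus (f x) (g x) (h x)
  zero := fun _ => zero
  compl f := fun x => compl (f x)
  orth_symm h := fun x => orth_symm (h x)
  oplus_comm _ _ h := funext fun x => oplus_comm _ _ (h x)
  oplus_assoc _ _ _ hgk hf :=
    ⟨fun x => (oplus_assoc _ _ _ (hgk x) (hf x)).1,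
      fun x => (oplus_assoc _ _ _ (hgk x) (hf x)).2.1,
      funext fun x => (oplus_assoc _ _ _ (hgk x) (hf x)).2.2⟩
  zero_orth f := fun x => zero_orth (f x)
  zero_oplus f := funext fun x => zero_oplus (f x)
  orth_compl f := fun x => orth_compl (f x)
  oplus_compl f := funext fun x => oplus_compl (f x)
  eq_compl _ _ h e := funext fun x => eq_compl _ _ (h x) (congrFun e x)
  eq_zero _ h := funext fun x => eq_zero _ (h x)

end EffectAlgebra

open EffectAlgebra (Orth oplus)

/-- An effect module: an effect algebra with a scalar multiplication by `[0,1]`. -/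
class EffectModule (E : Type u) extends EffectAlgebra E where
  /-- Scalar multiplication. -/
  scale : I → E → E
  one_scale : ∀ x : E, scale 1 x = x
  mul_scale : ∀ (r s : I) (x : E), scale (r * s) x = scale r (scale s x)
  add_scale : ∀ (r s : I) (h : EffectAlgebra.Orth r s) (x : E),
    ∃ h' : Orth (scale r x) (scale s x),
      scale (EffectAlgebra.oplus r s h) x = oplus (scale r x) (scale s x) h'
  scale_oplus : ∀ (r : I) (x y : E) (h : Orth x y),
    ∃ h' : Orth (scale r x) (scale r y),
      scale r (oplus x y h) = oplus (scale r x) (scale r y) h'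

namespace EffectModule

open EffectAlgebra

instance instUnitInterval : EffectModule I where
  scale r s := r * s
  one_scale := one_mul
  mul_scale := mul_assoc
  add_scale r s h x := by
    refine ⟨?_, Subtype.ext (add_mul (r : ℝ) s x)⟩
    change (r : ℝ) * x + s * x ≤ 1
    have h' : (r : ℝ) + s ≤ 1 := h
    nlinarith [x.2.1, x.2.2]
  scale_oplus r x y h := by
    refine ⟨?_, Subtype.ext (mul_add (r : ℝ) x y)⟩
    change (r : ℝ) * x + r * y ≤ 1
    have h' : (x : ℝ) + y ≤ 1 := h
    nlinarith [r.2.1, r.2.2]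

instance instPi {X : Type v} {E : Type u} [EffectModule E] : EffectModule (X → E) where
  scale r f := fun x => scale r (f x)
  one_scale f := funext fun x => one_scale (f x)
  mul_scale r s f := funext fun x => mul_scale r s (f x)
  add_scale r s h f := ⟨fun x => (add_scale r s h (f x)).1,
    funext fun x => (add_scale r s h (f x)).2⟩
  scale_oplus r _ _ h := ⟨fun x => (scale_oplus r _ _ (h x)).1,
    funext fun x => (scale_oplus r _ _ (h x)).2⟩

/-- Homomorphisms of effect modules. -/
structure Hom (E : Type u) (D : Type v) [EffectModule E] [EffectModule D] where
  /-- The underlying function. -/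
  toFun : E → D
  map_scale : ∀ (r : I) (x : E), toFun (scale r x) = scale r (toFun x)
  map_one : toFun one = one
  map_oplus : ∀ (x y : E) (h : Orth x y),
    ∃ h' : Orth (toFun x) (toFun y), toFun (oplus x y h) = oplus (toFun x) (toFun y) h'

instance {E : Type u} {D : Type v} [EffectModule E] [EffectModule D] : FunLike (Hom E D) E D where
  coe := Hom.toFun
  coe_injective f g h := by cases f; cases g; congr

namespace Hom

variable {E : Type u} {D : Type v} {C : Type w} [EffectModule E] [EffectModule D] [EffectModule C]

@[ext] theorem ext {f g : Hom E D} (h : ∀ x, f x = g x) : f = g := DFunLike.ext f g h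

@[simp] theorem mk_apply (f : E → D) (h₁ h₂ h₃) (x : E) : (Hom.mk f h₁ h₂ h₃ : Hom E D) x = f x :=
  rfl

/-- The identity homomorphism. -/
def id (E : Type u) [EffectModule E] : Hom E E where
  toFun x := x
  map_scale _ _ := rfl
  map_one := rfl
  map_oplus _ _ h := ⟨h, rfl⟩

/-- Composition of homomorphisms. -/
def comp (g : Hom D C) (f : Hom E D) : Hom E C where
  toFun x := g (f x)
  map_scale r x := (congrArg g (f.map_scale r x)).trans (g.map_scale r _)
  map_one := (congrArg g f.map_one).trans g.map_one
  map_oplus x y h := by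
    obtain ⟨h₁, e₁⟩ := f.map_oplus x y h
    obtain ⟨h₂, e₂⟩ := g.map_oplus _ _ h₁
    exact ⟨h₂, (congrArg g e₁).trans e₂⟩

theorem map_compl (f : Hom E D) (x : E) : f (compl x) = compl (f x) := by
  obtain ⟨h, e⟩ := f.map_oplus x (compl x) (orth_compl x)
  exact eq_compl _ _ h (e.symm.trans ((congrArg f (oplus_compl x)).trans f.map_one))

theorem map_zero (f : Hom E D) : f zero = zero := by
  rw [zero_eq_compl_one, map_compl, zero_eq_compl_one (E := D)]
  exact congrArg EffectAlgebra.compl f.map_one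

@[simp] theorem id_apply (x : E) : Hom.id E x = x := rfl

@[simp] theorem comp_apply (g : Hom D C) (f : Hom E D) (x : E) : g.comp f x = g (f x) := rfl

end Hom

/-! #### The Archimedean property, the metric, and Banach effect modules -/

/-- The scalar `1/2`. -/
noncomputable def half : I := ⟨1 / 2, by norm_num, by norm_num⟩

/-- `½ x ≤ ½ y ⊕ (r/2) 1`. -/
def LeUpTo {E : Type u} [EffectModule E] (r : I) (x y : E) : Prop :=
  ∃ h : Orth (scale half y) (scale (half * r) one),
    Le (scale half x) (oplus (scale half y) (scale (half * r) one) h)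

/-- An effect module is Archimedean if `x ≤ y` follows from `½ x ≤ ½ y ⊕ (r/2) 1` for all
`r ∈ (0,1]`. -/
def IsArchimedean (E : Type u) [EffectModule E] : Prop :=
  ∀ x y : E, (∀ r : I, 0 < r → LeUpTo r x y) → Le x y

/-- The distance
`d(x,y) = max (inf {r ∈ (0,1] | ½ x ≤ ½ y ⊕ (r/2) 1}) (inf {r ∈ (0,1] | ½ y ≤ ½ x ⊕ (r/2) 1})`. -/
noncomputable def distance {E : Type u} [EffectModule E] (x y : E) : ℝ :=
  max (sInf {r : ℝ | ∃ s : I, 0 < s ∧ (s : ℝ) = r ∧ LeUpTo s x y})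
    (sInf {r : ℝ | ∃ s : I, 0 < s ∧ (s : ℝ) = r ∧ LeUpTo s y x})

/-- Every Cauchy sequence for the distance converges. -/
def IsMetricComplete (E : Type u) [EffectModule E] : Prop :=
  ∀ a : ℕ → E,
    (∀ ε : ℝ, 0 < ε → ∃ N, ∀ m n, N ≤ m → N ≤ n → distance (a m) (a n) < ε) →
      ∃ x : E, ∀ ε : ℝ, 0 < ε → ∃ N, ∀ n, N ≤ n → distance (a n) x < ε

end EffectModule

/-- The category of effect modules. -/
structure EMod where
  /-- The underlying set. -/
  carrier : Type u
  [str : EffectModule carrier]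

attribute [instance] EMod.str

instance : Category EMod.{u} where
  Hom M N := EffectModule.Hom M.carrier N.carrier
  id M := EffectModule.Hom.id M.carrier
  comp f g := EffectModule.Hom.comp g f

/-- Banach effect modules: Archimedean and complete. -/
def EMod.IsBanach : ObjectProperty EMod.{u} := fun M =>
  EffectModule.IsArchimedean M.carrier ∧ EffectModule.IsMetricComplete M.carrier

/-- The full subcategory of Banach effect modules. -/
abbrev BEMod := EMod.IsBanach.{u}.FullSubcategory

/-! ### The expectation monad -/

/-- `𝓔(X) = EMod([0,1]^X, [0,1])`. -/
abbrev Expectation (X : Type u) : Type u := EffectModule.Hom (X → I) I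

namespace Expectation

/-- `𝓔(f)(h)(p) = h(p ∘ f)`. -/
def map {X : Type u} {Y : Type v} (f : X → Y) (h : Expectation X) : Expectation Y where
  toFun p := h (p ∘ f)
  map_scale r p := h.map_scale r (p ∘ f)
  map_one := h.map_one
  map_oplus p q o := h.map_oplus (p ∘ f) (q ∘ f) fun x => o (f x)

/-- `η(x)(p) = p(x)`. -/
def unit {X : Type u} (x : X) : Expectation X where
  toFun p := p x
  map_scale _ _ := rfl
  map_one := rfl
  map_oplus _ _ o := ⟨o x, rfl⟩

/-- For an effect module `M` and `h ∈ 𝓔(EMod(M,[0,1]))`, the state `y ↦ h(k ↦ k(y))` of `M`. -/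
def average {M : Type v} [EffectModule M] (h : Expectation (EffectModule.Hom M I)) :
    EffectModule.Hom M I where
  toFun y := h fun k => k y
  map_scale r y :=
    (congrArg h (funext fun k => k.map_scale r y)).trans (h.map_scale r fun k => k y)
  map_one := (congrArg h (funext fun k => k.map_one)).trans h.map_one
  map_oplus x y o := by
    obtain ⟨o', e⟩ := h.map_oplus (fun k => k x) (fun k => k y) fun k => (k.map_oplus x y o).1
    exact ⟨o', (congrArg h (funext fun k => (k.map_oplus x y o).2)).trans e⟩

/-- `μ(h)(p) = h(k ↦ k(p))`. -/
def mult {X : Type u} (h : Expectation (Expectation X)) : Expectation X := average h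

end Expectation

/-- The expectation monad on the category of sets. -/
def expectationMonad : CategoryTheory.Monad (Type u) where
  obj X := Expectation X
  map f := ↾(Expectation.map f)
  η := { app := fun X => ↾(Expectation.unit (X := X)) }
  μ := { app := fun X => ↾(Expectation.mult (X := X)) }
  assoc _ := rfl
  left_unit _ := rfl
  right_unit _ := rfl

/-- The category of Eilenberg–Moore algebras of the expectation monad. -/
abbrev EAlg := expectationMonad.{u}.Algebra

namespace EAlg

/-- The structure map `𝓔(X) → X` of an algebra as a function. -/
def act (A : EAlg.{u}) : Expectation A.A → A.A := fun h => A.a h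

theorem act_unit (A : EAlg.{u}) (x : A.A) : A.act (Expectation.unit x) = x :=
  ConcreteCategory.congr_hom A.unit x

theorem act_mult (A : EAlg.{u}) (h : Expectation (Expectation A.A)) :
    A.act (Expectation.mult h) = A.act (Expectation.map A.act h) :=
  ConcreteCategory.congr_hom A.assoc h

theorem map_act {A B : EAlg.{u}} (f : A ⟶ B) (h : Expectation A.A) :
    f.f (A.act h) = B.act (Expectation.map (fun x => f.f x) h) :=
  (ConcreteCategory.congr_hom f.h h).symm

end EAlg

/-! ### Convex compact Hausdorff spaces -/

/-- A convex compact Hausdorff space: a set carrying a compact Hausdorff topology and a convex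
structure, i.e. an algebra of the monad of finitely supported probability distributions. -/
structure CCH where
  /-- The underlying set. -/
  carrier : Type u
  [top : TopologicalSpace carrier]
  [compact : CompactSpace carrier]
  [hausdorff : T2Space carrier]
  [convex : ConvexSpace ℝ carrier]

namespace CCH

attribute [instance] top compact hausdorff convex

/-- Affine continuous maps. -/
@[ext]
structure Hom (X Y : CCH.{u}) where
  /-- The underlying function. -/
  toFun : X.carrier → Y.carrier
  continuous : Continuous toFun
  affine : IsAffineMap ℝ toFun

instance : Category CCH.{u} where
  Hom := Hom
  id _ := ⟨id, continuous_id, IsAffineMap.id⟩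
  comp f g := ⟨g.toFun ∘ f.toFun, g.continuous.comp f.continuous, g.affine.comp f.affine⟩

/-- Affine continuous maps `q : X → [0,1]` (affine means `q(∑ rᵢ xᵢ) = ∑ rᵢ q(xᵢ)`). -/
def IsAffineContinuous (X : CCH.{u}) (q : X.carrier → I) : Prop :=
  Continuous q ∧ IsAffineMap ℝ fun x => (q x : ℝ)

/-- A convex compact Hausdorff space is observable if the affine continuous maps to `[0,1]` are
jointly monic. -/
def IsObservable : ObjectProperty CCH.{u} := fun X =>
  ∀ x x' : X.carrier, (∀ q : X.carrier → I, X.IsAffineContinuous q → q x = q x') → x = x'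

end CCH

/-- The full subcategory of observable convex compact Hausdorff spaces. -/
abbrev CCHObs := CCH.IsObservable.{u}.FullSubcategory

/-! ### The space underlying an algebra of the expectation monad -/

namespace Expectation

/-- The limit along an ultrafilter `F` of the values of `p : X → [0,1]`. -/
noncomputable def ultraLim {X : Type u} (F : Ultrafilter X) (p : X → I) : I := (F.map p).lim

theorem tendsto_ultraLim {X : Type u} (F : Ultrafilter X) (p : X → I) :
    Tendsto p F (𝓝 (ultraLim F p)) := (F.map p).le_nhds_lim

theorem ultraLim_eq {X : Type u} {F : Ultrafilter X} {p : X → I} {r : I}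
    (h : Tendsto p F (𝓝 r)) : ultraLim F p = r :=
  tendsto_nhds_unique (tendsto_ultraLim F p) h

theorem tendsto_coe_ultraLim {X : Type u} (F : Ultrafilter X) (p : X → I) :
    Tendsto (fun x => (p x : ℝ)) F (𝓝 (ultraLim F p : ℝ)) :=
  (continuous_subtype_val.tendsto _).comp (tendsto_ultraLim F p)

theorem coe_ultraLim_eq {X : Type u} {F : Ultrafilter X} {p : X → I} {r : ℝ}
    (h : Tendsto (fun x => (p x : ℝ)) F (𝓝 r)) : (ultraLim F p : ℝ) = r :=
  tendsto_nhds_unique (tendsto_coe_ultraLim F p) h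

/-- The expectation `τ(F)` given by an ultrafilter `F`: `τ(F)(p)` is the limit of `p` along `F`. -/
noncomputable def ofUltrafilter {X : Type u} (F : Ultrafilter X) : Expectation X where
  toFun p := ultraLim F p
  map_scale r p := Subtype.ext <| coe_ultraLim_eq <| by
    exact (tendsto_coe_ultraLim F p).const_mul (r : ℝ)
  map_one := ultraLim_eq tendsto_const_nhds
  map_oplus p q h := by
    have h1 := (tendsto_coe_ultraLim F p).add (tendsto_coe_ultraLim F q)
    exact ⟨le_of_tendsto' h1 h, Subtype.ext (coe_ultraLim_eq h1)⟩

/-- The expectation `σ(φ)` given by a finitely supported probability distribution `φ`: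
`σ(φ)(p) = ∑ₓ φ(x) p(x)`. -/
noncomputable def ofDistribution {X : Type u} (φ : StdSimplex ℝ X) : Expectation X where
  toFun p := ⟨φ.weights.sum fun x r => r * (p x : ℝ),
    Finsupp.sum_nonneg fun x _ => mul_nonneg (φ.nonneg x) (p x).2.1,
    (Finset.sum_le_sum fun x _ =>
      mul_le_of_le_one_right (φ.nonneg x) (p x).2.2).trans φ.total.le⟩
  map_scale r p := Subtype.ext <| by
    simp only [EffectModule.scale, Finsupp.sum, Set.Icc.coe_mul, Finset.mul_sum]
    exact Finset.sum_congr rfl fun x _ => by ring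
  map_one := Subtype.ext <| by
    simp [EffectAlgebra.one, EffectAlgebra.compl, EffectAlgebra.zero]
  map_oplus p q h := by
    have e : (φ.weights.sum fun x r => r * ((p x : ℝ) + q x)) =
        (φ.weights.sum fun x r => r * (p x : ℝ)) + φ.weights.sum fun x r => r * (q x : ℝ) := by
      simp only [Finsupp.sum, mul_add, Finset.sum_add_distrib]
    refine ⟨?_, Subtype.ext e⟩
    refine e.symm.le.trans ((Finset.sum_le_sum fun x _ =>
      mul_le_of_le_one_right (φ.nonneg x) (h x)).trans φ.total.le)

theorem coe_ofDistribution {X : Type u} (φ : StdSimplex ℝ X) (p : X → I) :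
    (ofDistribution φ p : ℝ) = φ.weights.sum fun x r => r * (p x : ℝ) := rfl

theorem map_ofDistribution {X : Type u} {Y : Type v} (f : X → Y) (φ : StdSimplex ℝ X) :
    map f (ofDistribution φ) = ofDistribution (φ.map f) := by
  ext p
  change (φ.weights.sum fun x r => r * (p (f x) : ℝ)) = _
  rw [coe_ofDistribution, StdSimplex.weights_map,
    Finsupp.sum_mapDomain_index (by simp) (by intros; ring)]

theorem ofDistribution_single {X : Type u} (x : X) :
    ofDistribution (StdSimplex.single x) = unit x := by
  ext p
  rw [coe_ofDistribution, StdSimplex.weights_single, Finsupp.sum_single_index (by simp), one_mul]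
  rfl

theorem mult_ofDistribution {X : Type u} (Φ : StdSimplex ℝ (StdSimplex ℝ X)) :
    mult (map ofDistribution (ofDistribution Φ)) = ofDistribution Φ.sConvexComb := by
  ext p
  change (Φ.weights.sum fun φ r => r * (ofDistribution φ p : ℝ)) = _
  rw [coe_ofDistribution, StdSimplex.weights_sConvexComb,
    Finsupp.sum_sum_index (by simp) (by intros; ring)]
  refine Finset.sum_congr rfl fun φ _ => ?_
  change _ * (ofDistribution φ p : ℝ) = _
  change _ = (Φ.weights φ • φ.weights).sum fun x r => r * (p x : ℝ)
  rw [coe_ofDistribution, Finsupp.sum_smul_index (by simp), Finsupp.mul_sum]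
  exact Finset.sum_congr rfl fun x _ => by ring

theorem map_map {X : Type u} {Y : Type v} {Z : Type w} (g : Y → Z) (f : X → Y)
    (h : Expectation X) : map g (map f h) = map (fun x => g (f x)) h := rfl

theorem ultraLim_join {X : Type u} (A : Ultrafilter (Ultrafilter X)) (p : X → I) :
    ultraLim (joinM A) p = ultraLim (A.map ofUltrafilter) fun k => k p := by
  apply ultraLim_eq
  have h := tendsto_ultraLim (A.map ofUltrafilter) fun k => k p
  intro U hU
  obtain ⟨V, hVU, hVo, hV⟩ := mem_nhds_iff.1 hU
  have hA : {G : Ultrafilter X | ultraLim G p ∈ V} ∈ A := h (hVo.mem_nhds hV)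
  change {G : Ultrafilter X | p ⁻¹' U ∈ G} ∈ A
  filter_upwards [hA] with G hG
  exact tendsto_ultraLim G p (mem_of_superset (hVo.mem_nhds hG) hVU)

end Expectation

/-- The monad map `τ` from the ultrafilter monad to the expectation monad. -/
noncomputable def ultrafilterToExpectation :
    MonadHom (ofTypeMonad Ultrafilter) expectationMonad.{u} where
  app X := ↾(Expectation.ofUltrafilter (X := X))
  naturality X Y f := rfl
  app_η X := by
    ext x
    apply EffectModule.Hom.ext
    intro p
    exact Expectation.ultraLim_eq (tendsto_pure_nhds p x)
  app_μ X := by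
    ext A
    apply EffectModule.Hom.ext
    intro p
    exact Expectation.ultraLim_join A p

namespace EAlg

/-- The ultrafilter algebra `α ∘ τ` underlying an algebra `α` of the expectation monad. -/
noncomputable def toCompactum (A : EAlg.{u}) : Compactum.{u} :=
  (Monad.algebraFunctorOfMonadHom ultrafilterToExpectation).obj A

/-- The topology of an algebra `α : 𝓔(X) → X`: a set `U` is open iff every ultrafilter `F` with
`α(τ(F)) ∈ U` contains `U`. -/
noncomputable instance topology (A : EAlg.{u}) : TopologicalSpace A.A :=
  inferInstanceAs (TopologicalSpace A.toCompactum)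

instance (A : EAlg.{u}) : CompactSpace A.A := inferInstanceAs (CompactSpace A.toCompactum)

instance (A : EAlg.{u}) : T2Space A.A := inferInstanceAs (T2Space A.toCompactum)

theorem isClosed_iff (A : EAlg.{u}) (U : Set A.A) :
    IsClosed U ↔ ∀ F : Ultrafilter A.A, U ∈ F → A.act (Expectation.ofUltrafilter F) ∈ U :=
  Compactum.isClosed_iff (X := A.toCompactum) U

/-- The convex structure of an algebra `α : 𝓔(X) → X`: a formal convex combination `φ` is
interpreted as `α(σ(φ))`. -/
noncomputable instance convexSpace (A : EAlg.{u}) : ConvexSpace ℝ A.A :=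
  ConvexSpace.mk (fun φ => A.act (Expectation.ofDistribution φ))
    (fun x => by
      rw [Expectation.ofDistribution_single, A.act_unit])
    (fun Φ => by
      have e := Expectation.map_ofDistribution (fun φ => A.act (Expectation.ofDistribution φ)) Φ
      rw [← e, ← Expectation.mult_ofDistribution, A.act_mult, Expectation.map_map])

/-- The convex compact Hausdorff space underlying an algebra. -/
noncomputable abbrev toCCHObj (A : EAlg.{u}) : CCH.{u} := ⟨A.A⟩

/-- The comparison functor from algebras of the expectation monad to convex compact Hausdorff
spaces, which is the identity on underlying sets and functions. -/
noncomputable def toCCH : EAlg.{u} ⥤ CCH.{u} where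
  obj A := A.toCCHObj
  map {A B} f :=
    { toFun := fun x => f.f x
      continuous := Compactum.continuous_of_hom
        ((Monad.algebraFunctorOfMonadHom ultrafilterToExpectation).map f)
      affine := ⟨fun φ => (map_act f _).trans
        (congrArg B.act (Expectation.map_ofDistribution _ φ))⟩ }

/-- An algebra of the expectation monad is observable if its underlying convex compact Hausdorff
space is. -/
def IsObservable : ObjectProperty EAlg.{u} := fun A => CCH.IsObservable (toCCH.obj A)

end EAlg

/-- The full subcategory of observable algebras of the expectation monad. -/
abbrev EAlgObs := EAlg.IsObservable.{u}.FullSubcategory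

/-- The restriction of the comparison functor to observable objects. -/
noncomputable def EAlgObs.toCCHObs : EAlgObs.{u} ⥤ CCHObs.{u} :=
  CCH.IsObservable.lift (EAlg.IsObservable.ι ⋙ EAlg.toCCH) fun A => A.property

/-! ### The dual adjunction between algebras and effect modules -/

namespace EAlg

open EffectAlgebra EffectModule

/-- The algebra structure `h ↦ h(id)` on the unit interval. -/
def intervalAct (h : Expectation I) : I := h id

theorem intervalAct_unit (r : I) : intervalAct (Expectation.unit r) = r := rfl

theorem intervalAct_mult (h : Expectation (Expectation I)) :
    intervalAct (Expectation.mult h) = intervalAct (Expectation.map intervalAct h) := rfl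

/-- The algebra maps from `A` to the unit interval. -/
def Predicate (A : EAlg.{u}) : Type u :=
  {q : A.A → I // ∀ h : Expectation A.A, intervalAct (Expectation.map q h) = q (A.act h)}

namespace Predicate

variable {A : EAlg.{u}}

instance : FunLike (Predicate A) A.A I where
  coe := Subtype.val
  coe_injective := Subtype.val_injective

@[ext] theorem ext {p q : Predicate A} (h : ∀ x, p x = q x) : p = q := DFunLike.ext p q h

/-- The pointwise effect module structure on the algebra maps to the unit interval. -/
instance : EffectModule (Predicate A) where
  Orth p q := Orth p.1 q.1
  oplus p q h := ⟨oplus p.1 q.1 h, fun k => by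
    obtain ⟨h', e⟩ := k.map_oplus p.1 q.1 h
    refine e.trans (Subtype.ext ?_)
    exact congrArg₂ (fun r s : I => (r : ℝ) + s) (p.2 k) (q.2 k)⟩
  zero := ⟨zero, fun k => k.map_zero⟩
  compl p := ⟨EffectAlgebra.compl p.1, fun k =>
    (k.map_compl p.1).trans (congrArg EffectAlgebra.compl (p.2 k))⟩
  orth_symm h := orth_symm h
  oplus_comm p q h := Subtype.ext (oplus_comm p.1 q.1 h)
  oplus_assoc p q r hqr hp :=
    ⟨(oplus_assoc p.1 q.1 r.1 hqr hp).1, (oplus_assoc p.1 q.1 r.1 hqr hp).2.1,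
      Subtype.ext (oplus_assoc p.1 q.1 r.1 hqr hp).2.2⟩
  zero_orth p := zero_orth p.1
  zero_oplus p := Subtype.ext (zero_oplus p.1)
  orth_compl p := orth_compl p.1
  oplus_compl p := Subtype.ext (oplus_compl p.1)
  eq_compl p q h e := Subtype.ext (eq_compl p.1 q.1 h (congrArg Subtype.val e))
  eq_zero p h := Subtype.ext (eq_zero p.1 h)
  scale r p := ⟨scale r p.1, fun k =>
    (k.map_scale r p.1).trans (congrArg (scale r) (p.2 k))⟩
  one_scale p := Subtype.ext (one_scale p.1)
  mul_scale r s p := Subtype.ext (mul_scale r s p.1)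
  add_scale r s h p := ⟨(add_scale r s h p.1).1, Subtype.ext (add_scale r s h p.1).2⟩
  scale_oplus r p q h := ⟨(scale_oplus r p.1 q.1 h).1, Subtype.ext (scale_oplus r p.1 q.1 h).2⟩

/-- Precomposition with an algebra map. -/
def pullback {A B : EAlg.{u}} (g : A ⟶ B) : EffectModule.Hom (Predicate B) (Predicate A) where
  toFun q := ⟨fun x => q (g.f x), fun h =>
    (q.2 (Expectation.map (fun x => g.f x) h)).trans (congrArg q (map_act g h).symm)⟩
  map_scale _ _ := rfl
  map_one := rfl
  map_oplus _ _ h := ⟨fun x => h (g.f x), rfl⟩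

end Predicate

end EAlg

/-- The effect module of algebra maps from `A` to the unit interval. -/
def predicateModule (A : EAlg.{u}) : EMod.{u} := ⟨A.Predicate⟩

/-- The functor `Alg(𝓔) → EModᵒᵖ` sending an algebra to the effect module of its algebra maps to
`[0,1]`, and an algebra map `g` to `q ↦ q ∘ g`. -/
def predicateFunctor : EAlg.{u} ⥤ EMod.{u}ᵒᵖ where
  obj A := op (predicateModule A)
  map g := Quiver.Hom.op (X := predicateModule _) (Y := predicateModule _)
    (EAlg.Predicate.pullback g)

/-- The algebra of states of an effect module `M`: the set `EMod(M,[0,1])` with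
`α_M(h)(y) = h(k ↦ k(y))`. -/
def stateAlg (M : EMod.{u}) : EAlg.{u} where
  A := EffectModule.Hom M.carrier I
  a := ↾(Expectation.average (M := M.carrier))
  unit := rfl
  assoc := rfl

/-- The states functor `EModᵒᵖ → Alg(𝓔)`, sending `f` to `k ↦ k ∘ f`. -/
def stateFunctor : EMod.{u}ᵒᵖ ⥤ EAlg.{u} where
  obj M := stateAlg M.unop
  map {M N} f :=
    { f := ↾(fun k : EffectModule.Hom M.unop.carrier I => EffectModule.Hom.comp k f.unop)
      h := rfl }

/-- Evaluation `x ↦ (q ↦ q(x))` from an algebra to the states of its effect module. -/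
def evalState (A : EAlg.{u}) : A ⟶ stateAlg (predicateModule A) where
  f := ↾(fun x =>
    { toFun := fun q : A.Predicate => q x
      map_scale := fun _ _ => rfl
      map_one := rfl
      map_oplus := fun _ _ h => ⟨h x, rfl⟩ })
  h := by
    ext h
    apply EffectModule.Hom.ext
    intro q
    exact q.2 h

/-- Evaluation `y ↦ (k ↦ k(y))` from an effect module to the algebra maps on its states. -/
def evalPredicate (M : EMod.{u}) : M ⟶ predicateModule (stateAlg M) :=
  { toFun := fun y => ⟨fun k => EffectModule.Hom.toFun k y, fun _ => rfl⟩
    map_scale := fun r y => Subtype.ext (funext fun k => EffectModule.Hom.map_scale k r y)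
    map_one := Subtype.ext (funext fun k => EffectModule.Hom.map_one k)
    map_oplus := fun x y h =>
      ⟨fun k => (EffectModule.Hom.map_oplus k x y h).1,
        Subtype.ext (funext fun k => (EffectModule.Hom.map_oplus k x y h).2)⟩ }

/-- The dual adjunction between algebras of the expectation monad and effect modules, with unit
and counit given by evaluation. -/
def dualAdjunction : predicateFunctor.{u} ⊣ stateFunctor.{u} where
  unit := { app := evalState }
  counit := { app := fun M => (evalPredicate M.unop).op }

/-! ### Restriction of the adjunction to observable algebras and Banach effect modules -/

/-- The restriction of `predicateFunctor` to a functor from observable algebras to Banach effect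
modules, given that it maps the former to the latter. -/
def restrictedPredicates (hP : ∀ A : EAlg.{u}, A.IsObservable → (predicateModule A).IsBanach) :
    EAlgObs.{u} ⥤ BEMod.{u}ᵒᵖ where
  obj A := op ⟨predicateModule A.obj, hP A.obj A.property⟩
  map g := (ObjectProperty.homMk (predicateFunctor.map g.hom).unop).op

/-- The restriction of `stateFunctor` to a functor from Banach effect modules to observable
algebras, given that it maps the former to the latter. -/
def restrictedStates (hS : ∀ M : EMod.{u}, M.IsBanach → (stateAlg M).IsObservable) :
    BEMod.{u}ᵒᵖ ⥤ EAlgObs.{u} where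
  obj M := ⟨stateAlg M.unop.obj, hS M.unop.obj M.unop.property⟩
  map f := ObjectProperty.homMk (stateFunctor.map f.unop.hom.op)

/-- The dual adjunction restricted to the full subcategories of observable algebras and Banach
effect modules. -/
def restrictedAdjunction
    (hP : ∀ A : EAlg.{u}, A.IsObservable → (predicateModule A).IsBanach)
    (hS : ∀ M : EMod.{u}, M.IsBanach → (stateAlg M).IsObservable) :
    restrictedPredicates hP ⊣ restrictedStates hS where
  unit := { app := fun A => ObjectProperty.homMk (dualAdjunction.unit.app A.obj) }
  counit := { app := fun M => (ObjectProperty.homMk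
    (dualAdjunction.counit.app (op M.unop.obj)).unop).op }

/-!
The theorem rests on two separation arguments and on one approximation argument.

*States of an Archimedean effect module `M` determine its order*
(`EffectModule.IsArchimedean.orderDetermining`). A state is a positive functional on the formal
linear combinations of elements of `M`, so Hahn–Banach applies as soon as the cone of combinations
that have to be nonnegative is known to be small enough. The cone is controlled by giving formal
positive combinations a value in a total commutative monoid with cancellation, namely the germs at
`0⁺` of functions into `M` extended by one undefined element: the combination `∑ αₓ x`, which may
not exist in `M`, is interpreted by the germ of `t ↦ ∑ (t αₓ) x`.

*Expectations are limits of finitely supported distributions*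
(`EffectModule.OrderDetermining.exists_ultrafilter`). More generally, if a family of states
determines the order of `M`, every state of `M` is the limit of finite convex combinations of the
family along some ultrafilter, by separation in finite-dimensional spaces. Applied to the points
of `X` as states of `[0,1]^X`, this shows that an affine continuous function `q` on an algebra
satisfies `q (α h) = h q`, so that such functions are the same as algebra maps to `[0,1]`.
Applied to the points of an algebra `A` as states of its predicates, it shows that the unit of
the adjunction is surjective; observability is its injectivity.

*The counit is an isomorphism at a Banach effect module `M`.* By the first argument it is an
embedding, and its image is complete, so it suffices that the image is dense
(`EMod.exists_near_predicate`). If a predicate `q` on the states of `M` is not a uniform limit of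
elements in the span of `M`, another separation yields two expectations on the set of states that
agree on `M` but differ at `q` (`EffectModule.exists_expectations`). Both have the same average
state, and `q`, being an algebra map, cannot tell them apart.

For the isomorphism with observable convex compact Hausdorff spaces `X`, the same approximation
gives each expectation `h` on `X` a barycenter: the point at which every affine continuous `q` has
the value `h q`. It is unique by observability, and `h ↦ CCH.barycenter h` is the only algebra
structure that induces the given topology and convex structure.
-/

/-! ### The total commutative monoid of an effect algebra -/

namespace EffectAlgebra

/-- An effect algebra with one absorbing element adjoined, as the value of the undefined sums.
The partial sum thereby becomes the total operation of a commutative monoid, in which a sum is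
of the form `of z` exactly when it is defined. -/
inductive Extended (E : Type u) : Type u where
  /-- A defined element. -/
  | of (x : E) : Extended E
  /-- The value of the undefined sums. -/
  | undefined : Extended E

namespace Extended

theorem of_injective {E : Type u} : Function.Injective (of : E → Extended E) :=
  fun _ _ => of.inj

theorem ext_of {E : Type u} {a b : Extended E} (h : ∀ z, a = of z ↔ b = of z) : a = b := by
  cases a with
  | of x => exact ((h x).1 rfl).symm
  | undefined =>
    cases b with
    | of y => exact (h y).2 rfl
    | undefined => rfl

variable {E : Type u} [EffectAlgebra E]

open scoped Classical in
noncomputable instance : Add (Extended E) where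
  add
    | of x, of y => if h : Orth x y then of (oplus x y h) else undefined
    | _, _ => undefined

instance : Zero (Extended E) where
  zero := of zero

theorem add_eq_of_iff {a b : Extended E} {z : E} :
    a + b = of z ↔ ∃ x y, a = of x ∧ b = of y ∧ ∃ h : Orth x y, oplus x y h = z := by
  classical
  constructor
  · intro e
    cases a with
    | undefined => cases e
    | of x =>
      cases b with
      | undefined => cases e
      | of y =>
        change (if h : Orth x y then of (oplus x y h) else undefined) = of z at e
        split_ifs at e with h
        exact ⟨x, y, rfl, rfl, h, of_injective e⟩
  · rintro ⟨x, y, rfl, rfl, h, rfl⟩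
    exact dif_pos h

theorem of_add_of {x y z : E} : of x + of y = of z ↔ ∃ h : Orth x y, oplus x y h = z := by
  rw [add_eq_of_iff]
  constructor
  · rintro ⟨x', y', hx, hy, h⟩
    rw [of_injective hx, of_injective hy]
    exact h
  · exact fun h => ⟨x, y, rfl, rfl, h⟩

theorem of_oplus {x y : E} (h : Orth x y) : of x + of y = of (oplus x y h) :=
  of_add_of.2 ⟨h, rfl⟩

protected theorem add_comm' (a b : Extended E) : a + b = b + a := by
  have key : ∀ (a b : Extended E) z, a + b = of z → b + a = of z := by
    intro a b z h
    obtain ⟨x, y, rfl, rfl, o, rfl⟩ := add_eq_of_iff.1 h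
    exact of_add_of.2 ⟨orth_symm o, (oplus_comm _ _ _).symm⟩
  exact ext_of fun z => ⟨key a b z, key b a z⟩

protected theorem zero_add' (a : Extended E) : 0 + a = a := by
  cases a with
  | of x => exact of_add_of.2 ⟨zero_orth x, zero_oplus x⟩
  | undefined => rfl

noncomputable instance : AddCommMonoid (Extended E) where
  add_assoc := by
    have key : ∀ (a b c : Extended E) z, a + (b + c) = of z → a + b + c = of z := by
      intro a b c z h
      obtain ⟨x, t, rfl, ht, o, rfl⟩ := add_eq_of_iff.1 h
      obtain ⟨y, s, rfl, rfl, o', rfl⟩ := add_eq_of_iff.1 ht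
      obtain ⟨hxy, hz, e⟩ := oplus_assoc _ _ _ o' o
      rw [e, of_oplus hxy, of_oplus hz]
    refine fun a b c => ext_of fun z => ⟨fun h => ?_, key a b c z⟩
    rw [Extended.add_comm', Extended.add_comm' b c]
    apply key
    rwa [Extended.add_comm', Extended.add_comm' b a]
  zero_add := Extended.zero_add'
  add_zero a := (Extended.add_comm' a 0).trans (Extended.zero_add' a)
  add_comm := Extended.add_comm'
  nsmul := nsmulRec

/-- A part of a defined sum is defined. -/
theorem exists_of_left {a b : Extended E} {z : E} (h : a + b = of z) : ∃ x, a = of x := by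
  obtain ⟨x, _, hx, _⟩ := add_eq_of_iff.1 h
  exact ⟨x, hx⟩

theorem exists_of_right {a b : Extended E} {z : E} (h : a + b = of z) : ∃ x, b = of x :=
  exists_of_left ((add_comm b a).trans h)

theorem of_add_compl (x : E) : of x + of (compl x) = of one :=
  of_add_of.2 ⟨orth_compl x, oplus_compl x⟩

theorem eq_compl_of_add {x y : E} (h : of x + of y = of one) : y = compl x := by
  obtain ⟨o, e⟩ := of_add_of.1 h
  exact eq_compl _ _ o e

theorem compl_compl (x : E) : compl (compl x) = x :=
  (eq_compl_of_add ((add_comm _ _).trans (of_add_compl x))).symm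

/-- Defined sums cancel. -/
theorem add_right_cancel_of {a b c : Extended E} {z : E} (h : a + c = b + c)
    (hz : a + c = of z) : a = b := by
  have key : ∀ a' : Extended E, a' + c = of z → ∃ x, a' = of x ∧ c + of (compl z) =
      of (compl x) := by
    intro a' h'
    obtain ⟨x, rfl⟩ := exists_of_left h'
    have e : of x + (c + of (compl z)) = of one := by
      rw [← add_assoc, h', of_add_compl]
    obtain ⟨y, hy⟩ := exists_of_right e
    rw [hy] at e ⊢
    exact ⟨x, rfl, congrArg of (eq_compl_of_add e)⟩
  obtain ⟨x, rfl, hx⟩ := key a hz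
  obtain ⟨y, rfl, hy⟩ := key b (h ▸ hz)
  have e := of_injective (hx.symm.trans hy)
  rw [← compl_compl x, e, compl_compl]

theorem le_iff {x y : E} : Le x y ↔ ∃ c, of x + c = of y := by
  constructor
  · rintro ⟨z, h, e⟩
    exact ⟨of z, of_add_of.2 ⟨h, e⟩⟩
  · rintro ⟨c, h⟩
    obtain ⟨z, rfl⟩ := exists_of_right h
    exact ⟨z, of_add_of.1 h⟩

theorem orth_iff {x y : E} : Orth x y ↔ ∃ z, of x + of y = of z :=
  ⟨fun h => ⟨_, of_oplus h⟩, fun ⟨_, h⟩ => (of_add_of.1 h).1⟩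

end Extended

open Extended

variable {E : Type u} [EffectAlgebra E]

theorem Le.antisymm {x y : E} (h : Le x y) (h' : Le y x) : x = y := by
  obtain ⟨a, ha⟩ := le_iff.1 h
  obtain ⟨b, hb⟩ := le_iff.1 h'
  have e : b + a = 0 := by
    refine add_right_cancel_of (c := of y) (z := y) ?_ ?_ <;>
    rw [add_comm b a, add_comm, ← add_assoc, add_right_comm, hb, ha]
    rw [zero_add]
  have hb0 : b = 0 := by
    have e1 : of one + b + a = of one := by rw [add_assoc, e, add_zero]
    obtain ⟨z, hz⟩ := exists_of_left e1
    obtain ⟨c, rfl⟩ := exists_of_right hz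
    rw [add_comm] at hz
    exact congrArg of (eq_zero c (of_add_of.1 hz).1)
  rw [hb0, add_zero] at hb
  exact (of_injective hb).symm

theorem Orth.mono {x y x' y' : E} (h : Orth x y) (hx : Le x' x) (hy : Le y' y) : Orth x' y' := by
  obtain ⟨z, hz⟩ := orth_iff.1 h
  obtain ⟨a, ha⟩ := le_iff.1 hx
  obtain ⟨b, hb⟩ := le_iff.1 hy
  rw [← ha, ← hb, add_add_add_comm] at hz
  exact orth_iff.2 (exists_of_left hz)

theorem orth_iff_le_compl {x y : E} : Orth x y ↔ Le x (compl y) := by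
  constructor
  · intro h
    obtain ⟨z, hz⟩ := orth_iff.1 h
    have e : of y + (of x + of (compl z)) = of one := by
      rw [← add_assoc, add_comm (of y), hz, of_add_compl]
    obtain ⟨t, ht⟩ := exists_of_right e
    rw [ht] at e
    exact le_iff.2 ⟨_, ht.trans (congrArg of (eq_compl_of_add e))⟩
  · intro h
    exact Orth.mono (orth_symm (orth_compl y)) h (le_iff.2 ⟨0, add_zero _⟩)

end EffectAlgebra

/-! ### Scalar multiples, convex combinations and states in effect modules -/

namespace EffectModule

open EffectAlgebra EffectAlgebra.Extended

variable {M : Type u} [EffectModule M]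

theorem of_scale_add {r s t : I} (h : (r : ℝ) + s = t) (x : M) :
    of (scale r x) + of (scale s x) = of (scale t x) := by
  have o : Orth r s := h.le.trans t.2.2
  have e : oplus r s o = t := Subtype.ext h
  obtain ⟨h', e'⟩ := add_scale r s o x
  rw [of_oplus h', ← e', e]

theorem of_scale_oplus (r : I) {x y z : M} (h : of x + of y = of z) :
    of (scale r x) + of (scale r y) = of (scale r z) := by
  obtain ⟨o, rfl⟩ := of_add_of.1 h
  obtain ⟨h', e'⟩ := scale_oplus r x y o
  rw [of_oplus h', ← e']

theorem zero_scale (x : M) : scale 0 x = zero := by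
  have h : of (scale 0 x) + of (scale 0 x) = of (scale 0 x) := of_scale_add (by simp) x
  exact of_injective (add_right_cancel_of (h.trans (zero_add _).symm) h)

theorem scale_le_scale_one (r : I) (x : M) : Le (scale r x) (scale r one) :=
  le_iff.2 ⟨_, of_scale_oplus r (of_add_compl x)⟩

/-- `r x` and `s y` can be added when `r + s ≤ 1`. -/
theorem orth_scale {r s : I} (h : (r : ℝ) + s ≤ 1) (x y : M) : Orth (scale r x) (scale s y) := by
  have o : Orth (scale r (one : M)) (scale s one) := (add_scale r s h one).1
  exact o.mono (scale_le_scale_one r x) (scale_le_scale_one s y)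

theorem coe_one : ((one : I) : ℝ) = 1 := by
  change ((unitInterval.symm 0 : I) : ℝ) = 1
  simp

namespace Hom

theorem coe_map_add (k : Hom M I) {x y z : M} (h : of x + of y = of z) :
    (k x : ℝ) + k y = k z := by
  obtain ⟨o, rfl⟩ := of_add_of.1 h
  exact congrArg Subtype.val (k.map_oplus x y o).2.symm

theorem coe_map_oplus (k : Hom M I) {x y : M} (h : Orth x y) :
    (k (oplus x y h) : ℝ) = k x + k y := (k.coe_map_add (of_oplus h)).symm

theorem coe_map_scale (k : Hom M I) (r : I) (x : M) : (k (scale r x) : ℝ) = r * k x :=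
  congrArg Subtype.val (k.map_scale r x)

theorem coe_map_one (k : Hom M I) : (k one : ℝ) = 1 :=
  (congrArg Subtype.val k.map_one).trans coe_one

theorem coe_map_compl (k : Hom M I) (x : M) : (k (compl x) : ℝ) = 1 - k x :=
  congrArg Subtype.val (k.map_compl x)

theorem coe_map_zero (k : Hom M I) : (k zero : ℝ) = 0 :=
  congrArg Subtype.val k.map_zero

theorem mono (k : Hom M I) {x y : M} (h : Le x y) : (k x : ℝ) ≤ k y := by
  obtain ⟨z, o, rfl⟩ := h
  rw [coe_map_oplus]
  exact le_add_of_nonneg_right (k z).2.1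

end Hom

theorem exists_convexComb (r : I) (x y : M) :
    ∃ z : M, ∀ k : Hom M I, (k z : ℝ) = r * k x + (1 - r) * k y := by
  have o : Orth (scale r x) (scale (unitInterval.symm r) y) := orth_scale (by simp) x y
  exact ⟨oplus _ _ o, fun k => by simp [k.coe_map_oplus, k.coe_map_scale]⟩

theorem coe_half : (half : ℝ) = 1 / 2 := rfl

/-! ### Families of states that determine the order -/

/-- A state satisfies the inequality between real numbers that `LeUpTo` stands for. -/
theorem LeUpTo.map_le {r : I} {x y : M} (h : LeUpTo r x y) (k : Hom M I) :
    (k x : ℝ) ≤ k y + r := by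
  obtain ⟨o, h⟩ := h
  have := k.mono h
  simp only [k.coe_map_oplus, k.coe_map_scale, k.coe_map_one, Set.Icc.coe_mul, coe_half] at this
  linarith

/-- A family of states determines the order if `x ≤ y` can be checked on it. -/
def OrderDetermining {Z : Type v} (K : Z → Hom M I) : Prop :=
  ∀ x y : M, (∀ z, (K z x : ℝ) ≤ K z y) → Le x y

theorem leUpTo_one (x y : M) : LeUpTo 1 x y := by
  have o : Orth (scale half y) (scale (half * 1) one) :=
    orth_scale (by rw [mul_one, coe_half]; norm_num) _ _
  refine ⟨o, ?_⟩
  rw [le_iff, ← of_oplus o, mul_one]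
  obtain ⟨c, hc⟩ := le_iff.1 (scale_le_scale_one half x)
  exact ⟨c + of (scale half y), by rw [← add_assoc, hc, add_comm]⟩

namespace OrderDetermining

variable {Z : Type v} {K : Z → Hom M I}

theorem eq (hK : OrderDetermining K) {x y : M} (h : ∀ z, K z x = K z y) : x = y :=
  (hK x y fun z => (congrArg Subtype.val (h z)).le).antisymm
    (hK y x fun z => (congrArg Subtype.val (h z)).ge)

theorem orth (hK : OrderDetermining K) {x y : M} (h : ∀ z, (K z x : ℝ) + K z y ≤ 1) :
    Orth x y :=
  orth_iff_le_compl.2 <| hK _ _ fun z => by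
    rw [Hom.coe_map_compl]
    linarith [h z]

theorem leUpTo (hK : OrderDetermining K) {r : I} {x y : M}
    (h : ∀ z, (K z x : ℝ) ≤ K z y + r) : LeUpTo r x y := by
  have o : Orth (scale half y) (scale (half * r) one) := orth_scale (by
    rw [Set.Icc.coe_mul, coe_half]
    linarith [r.2.2]) _ _
  refine ⟨o, hK _ _ fun z => ?_⟩
  simp only [Hom.coe_map_oplus, Hom.coe_map_scale, Hom.coe_map_one, Set.Icc.coe_mul, coe_half]
  linarith [h z]

theorem isArchimedean (hK : OrderDetermining K) : IsArchimedean M := by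
  intro x y h
  refine hK _ _ fun z => le_of_forall_pos_le_add fun ε hε => ?_
  have hm : 0 < min ε 1 := lt_min hε one_pos
  have := (h ⟨min ε 1, hm.le, min_le_right _ _⟩ hm).map_le (K z)
  exact this.trans (add_le_add_right (min_le_left ε 1) _)

end OrderDetermining

theorem sInf_leUpTo_le {x y : M} {r : I} (hr : 0 < r) (h : LeUpTo r x y) :
    sInf {r : ℝ | ∃ s : I, 0 < s ∧ (s : ℝ) = r ∧ LeUpTo s x y} ≤ r :=
  csInf_le ⟨0, by rintro _ ⟨s, _, rfl, _⟩; exact s.2.1⟩ ⟨r, hr, rfl, h⟩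

theorem map_le_add_of_distance_lt {x y : M} {ε : ℝ} (h : distance x y < ε) (k : Hom M I) :
    |(k x : ℝ) - k y| ≤ ε := by
  have key : ∀ x y : M, sInf {r : ℝ | ∃ s : I, 0 < s ∧ (s : ℝ) = r ∧ LeUpTo s x y} < ε →
      (k x : ℝ) ≤ k y + ε := by
    intro x y h
    have hne : {r : ℝ | ∃ s : I, 0 < s ∧ (s : ℝ) = r ∧ LeUpTo s x y}.Nonempty :=
      ⟨1, 1, one_pos, rfl, leUpTo_one x y⟩
    obtain ⟨_, ⟨s, _, rfl, hs⟩, hlt⟩ := exists_lt_of_csInf_lt hne h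
    linarith [hs.map_le k]
  obtain ⟨h1, h2⟩ := max_lt_iff.1 h
  rw [abs_le]
  constructor <;> linarith [key _ _ h1, key _ _ h2]

theorem OrderDetermining.distance_le {Z : Type v} {K : Z → Hom M I} (hK : OrderDetermining K)
    {x y : M} {ε : ℝ} (hε : 0 < ε) (h : ∀ z, |(K z x : ℝ) - K z y| ≤ ε) : distance x y ≤ ε := by
  have hm : 0 < min ε 1 := lt_min hε one_pos
  let r : I := ⟨min ε 1, hm.le, min_le_right _ _⟩
  have key : ∀ x y : M, (∀ z, (K z x : ℝ) ≤ K z y + ε) → LeUpTo r x y := by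
    intro x y h
    refine hK.leUpTo fun z => ?_
    change (K z x : ℝ) ≤ K z y + min ε 1
    rw [← min_add_add_left]
    exact le_min (h z) (by linarith [(K z x).2.2, (K z y).2.1])
  refine (max_le (sInf_leUpTo_le (r := r) hm (key x y fun z => ?_))
    (sInf_leUpTo_le (r := r) hm (key y x fun z => ?_))).trans (min_le_left _ _)
  · linarith [(abs_le.1 (h z)).2]
  · linarith [(abs_le.1 (h z)).1]

/-! ### The linear span of an effect module in its functions on a family of states -/

/-- The space of functions spanned by the elements of `M`, as functions on a family of states.
Up to a positive factor and the shift by `1/2`, each of them comes from a single element. -/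
def stateSpan {Z : Type v} (K : Z → Hom M I) : Submodule ℝ (Z → ℝ) where
  carrier := {f | ∃ t : ℝ, 0 < t ∧ ∃ x : M, ∀ z, (K z x : ℝ) = 1 / 2 + t * f z}
  zero_mem' := ⟨1, one_pos, scale half one, fun z => by
    simp [Hom.coe_map_scale, Hom.coe_map_one, coe_half]⟩
  add_mem' := by
    rintro f g ⟨s, hs, x, hx⟩ ⟨t, ht, y, hy⟩
    have h1 : t / (s + t) ≤ 1 := (div_le_one (by positivity)).2 (by linarith)
    obtain ⟨z, hz⟩ := exists_convexComb ⟨t / (s + t), by positivity, h1⟩ x y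
    refine ⟨s * t / (s + t), by positivity, z, fun i => ?_⟩
    rw [hz, hx, hy, Pi.add_apply]
    simp only
    field_simp
    ring
  smul_mem' := by
    rintro c f ⟨t, ht, x, hx⟩
    rcases lt_trichotomy c 0 with hc | rfl | hc
    · refine ⟨t / (-c), div_pos ht (neg_pos.2 hc), compl x, fun z => ?_⟩
      have := hc.ne
      rw [Hom.coe_map_compl, hx, Pi.smul_apply, smul_eq_mul]
      field_simp
      ring
    · exact ⟨1, one_pos, scale half one, fun z => by
        simp [Hom.coe_map_scale, Hom.coe_map_one, coe_half]⟩
    · refine ⟨t / c, div_pos ht hc, x, fun z => ?_⟩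
      rw [hx, Pi.smul_apply, smul_eq_mul]
      field_simp

theorem mem_stateSpan {Z : Type v} (K : Z → Hom M I) (x : M) :
    (fun z => (K z x : ℝ)) ∈ stateSpan K := by
  have o : Orth (scale half one) (scale half x) := orth_scale (by rw [coe_half]; norm_num) _ _
  refine ⟨1 / 2, by norm_num, oplus _ _ o, fun z => ?_⟩
  rw [Hom.coe_map_oplus, Hom.coe_map_scale, Hom.coe_map_scale, Hom.coe_map_one, coe_half, mul_one]

theorem const_mem_stateSpan {Z : Type v} (K : Z → Hom M I) (c : ℝ) :
    (fun _ => c) ∈ stateSpan K := by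
  have := (stateSpan K).smul_mem c (mem_stateSpan K one)
  convert this using 1
  ext z
  simp [Hom.coe_map_one]

/-- If the states determine the order, each function in their span with values in the unit
interval comes from an element. -/
theorem OrderDetermining.exists_of_mem_stateSpan {Z : Type v} {K : Z → Hom M I}
    (hK : OrderDetermining K) {f : Z → ℝ} (hf : f ∈ stateSpan K) (h0 : ∀ z, 0 ≤ f z)
    (h1 : ∀ z, f z ≤ 1) : ∃ x : M, ∀ z, (K z x : ℝ) = f z := by
  obtain ⟨t, ht, x, hx⟩ := hf
  -- `t f` comes from `x ⊖ ½1`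
  have hle : Le (scale half one) x := hK _ _ fun z => by
    rw [hx, Hom.coe_map_scale, Hom.coe_map_one, coe_half]
    nlinarith [h0 z]
  obtain ⟨y, o, e⟩ := hle
  have hy : ∀ z, (K z y : ℝ) = t * f z := fun z => by
    have := hx z
    rw [← e, Hom.coe_map_oplus, Hom.coe_map_scale, Hom.coe_map_one, coe_half] at this
    linarith
  obtain ⟨n, hn⟩ := exists_nat_gt (1 / t)
  have hn0 : (0 : ℝ) < n := (by positivity : 0 < 1 / t).trans hn
  have hnt : 1 / (n * t) ≤ 1 := by
    rw [div_lt_iff₀ ht] at hn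
    exact (div_le_one (by positivity)).2 hn.le
  -- add up `n` copies of `f / n`
  have step : ∀ j : ℕ, j ≤ n → ∃ w : M, ∀ z, (K z w : ℝ) = j / n * f z := by
    intro j
    induction j with
    | zero => exact fun _ => ⟨zero, fun z => by simp [Hom.coe_map_zero]⟩
    | succ j ih =>
      intro hj
      obtain ⟨w, hw⟩ := ih (by omega)
      have hv : ∀ z, (K z (scale ⟨1 / (n * t), by positivity, hnt⟩ y) : ℝ) = 1 / n * f z := by
        intro z
        rw [Hom.coe_map_scale, hy]
        simp only
        field_simp
      have o : Orth w (scale ⟨1 / (n * t), by positivity, hnt⟩ y) := hK.orth fun z => by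
        rw [hw, hv, ← add_mul, ← add_div]
        refine mul_le_one₀ ((div_le_one hn0).2 ?_) (h0 z) (h1 z)
        exact_mod_cast hj
      refine ⟨oplus _ _ o, fun z => ?_⟩
      rw [Hom.coe_map_oplus, hw, hv]
      push_cast
      ring
  obtain ⟨w, hw⟩ := step n le_rfl
  exact ⟨w, fun z => by rw [hw, div_self hn0.ne', one_mul]⟩

end EffectModule

/-! ### A separation theorem for convex cones with an order unit -/

/-- The Hahn–Banach theorem for an ordered vector space with order unit `u`, where the order is
given by its cone `C` of positive elements: an element `w` that is not almost positive is
negative under some positive functional that takes the value `1` at `u`. -/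
theorem ConvexCone.exists_positive_functional {E : Type*} [AddCommGroup E] [Module ℝ E]
    (C : ConvexCone ℝ E) {a w : E} (ha : a ∈ C) (hunit : ∀ v, ∃ t : ℝ, t • a + v ∈ C)
    {ε : ℝ} (hε : 0 < ε) (hw : w + ε • a ∉ C) :
    ∃ f : E →ₗ[ℝ] ℝ, (∀ c ∈ C, 0 ≤ f c) ∧ f a = 1 ∧ f w < 0 := by
  have hup : ∀ {v : E} {s t : ℝ}, s ≤ t → s • a + v ∈ C → t • a + v ∈ C := by
    intro v s t hst h
    rcases hst.eq_or_lt with rfl | hst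
    · exact h
    · convert C.add_mem (C.smul_mem (sub_pos.2 hst) ha) h using 1
      rw [sub_smul]
      abel
  have hneg : ∀ t : ℝ, t • a ∈ C → 0 ≤ t := by
    intro t ht
    by_contra! h
    obtain ⟨s, hs⟩ := hunit w
    apply hw
    -- the multiple of `t • a` that brings the coefficient of `a` below `ε`
    have hd : 0 < (|s| + 1) / (-t) := div_pos (by positivity) (neg_pos.2 h)
    have := C.add_mem (C.smul_mem hd ht) hs
    rw [add_comm]
    refine hup (s := s - |s| - 1) (by linarith [le_abs_self s]) ?_
    convert this using 1
    rw [smul_smul, ← add_assoc, ← add_smul]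
    congr 2
    have := h.ne
    field_simp
    ring
  -- `v ↦ sInf (S v)` is the sublinear functional that dominates the extension
  let S : E → Set ℝ := fun v => {t | t • a - v ∈ C}
  have hne : ∀ v, (S v).Nonempty := fun v => by
    obtain ⟨t, ht⟩ := hunit (-v)
    exact ⟨t, by simpa [S, sub_eq_add_neg] using ht⟩
  have hbdd : ∀ v, BddBelow (S v) := fun v => by
    obtain ⟨t, ht⟩ := hunit v
    refine ⟨-t, fun s hs => ?_⟩
    have := hneg (s + t) (by
      convert C.add_mem hs ht using 1
      rw [add_smul]
      abel)
    linarith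
  have hmem : ∀ {v : E} {t : ℝ}, sInf (S v) < t → t • a - v ∈ C := by
    intro v t h
    obtain ⟨s, hs, hst⟩ := exists_lt_of_csInf_lt (hne v) h
    rw [sub_eq_add_neg]
    exact hup hst.le (by rw [← sub_eq_add_neg]; exact hs)
  have hwN : ε ≤ sInf (S (-w)) := by
    refine le_csInf (hne _) fun t ht => ?_
    by_contra! h
    apply hw
    rw [add_comm]
    refine hup h.le ?_
    rw [← sub_neg_eq_add]
    exact ht
  have hadd : ∀ x y, sInf (S (x + y)) ≤ sInf (S x) + sInf (S y) := by
    intro x y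
    refine le_of_forall_pos_le_add fun δ hδ => ?_
    have h1 := hmem (v := x) (t := sInf (S x) + δ / 2) (by linarith)
    have h2 := hmem (v := y) (t := sInf (S y) + δ / 2) (by linarith)
    refine csInf_le (hbdd _) ?_
    change _ • a - (x + y) ∈ C
    convert C.add_mem h1 h2 using 1
    module
  have hsmul_le : ∀ c : ℝ, 0 < c → ∀ x, sInf (S (c • x)) ≤ c * sInf (S x) := by
    intro c hc x
    refine le_of_forall_pos_le_add fun δ hδ => ?_
    have h1 := hmem (v := x) (t := sInf (S x) + δ / c) (by linarith [div_pos hδ hc])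
    refine csInf_le (hbdd _) ?_
    change _ • a - c • x ∈ C
    convert C.smul_mem hc h1 using 1
    rw [smul_sub, smul_smul, mul_add, mul_div_cancel₀ _ hc.ne']
  have hsmul : ∀ c : ℝ, 0 < c → ∀ x, sInf (S (c • x)) = c * sInf (S x) := by
    intro c hc x
    refine (hsmul_le c hc x).antisymm ?_
    have := hsmul_le c⁻¹ (inv_pos.2 hc) (c • x)
    rw [inv_smul_smul₀ hc.ne'] at this
    rwa [le_inv_mul_iff₀ hc] at this
  have hw0 : -w ≠ 0 := by
    intro h
    rw [neg_eq_zero] at h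
    rw [h, zero_add] at hw
    exact hw (C.smul_mem hε ha)
  obtain ⟨g, hg, hgN⟩ := exists_extension_of_le_sublinear
    (LinearPMap.mkSpanSingleton (-w) (sInf (S (-w))) hw0) (fun v => sInf (S v)) hsmul hadd (by
      rintro ⟨x, hx⟩
      obtain ⟨c, rfl⟩ := Submodule.mem_span_singleton.1 hx
      rw [LinearPMap.mkSpanSingleton'_apply]
      simp only [smul_eq_mul, RingHom.id_apply]
      rcases lt_trichotomy c 0 with hc | rfl | hc
      · have h1 := hsmul (-c) (neg_pos.2 hc) (-w)
        have h2 := hadd (c • (-w)) ((-c) • (-w))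
        rw [← add_smul, add_neg_cancel, zero_smul] at h2
        have h3 : 0 ≤ sInf (S 0) := le_csInf (hne 0) fun t ht => hneg t (by
          simpa [S] using ht)
        linarith
      · rw [zero_mul, zero_smul]
        exact le_csInf (hne 0) fun t ht => hneg t (by simpa [S] using ht)
      · exact (hsmul c hc _).ge)
  have hgw : g w < 0 := by
    have := hg ⟨-w, Submodule.mem_span_singleton_self _⟩
    rw [LinearPMap.mkSpanSingleton_apply] at this
    simp only [map_neg] at this
    linarith
  refine ⟨g, fun c hc => ?_, le_antisymm ?_ ?_, hgw⟩
  · have h1 := hgN (-c)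
    have h2 : sInf (S (-c)) ≤ 0 := csInf_le (hbdd _) (by simpa [S] using hc)
    rw [map_neg] at h1
    linarith
  · refine (hgN a).trans (le_of_forall_pos_le_add fun δ hδ => csInf_le (hbdd _) ?_)
    change (1 + δ) • a - a ∈ C
    convert C.smul_mem hδ ha using 1
    module
  · have h1 := hgN (-a)
    have h2 : sInf (S (-a)) ≤ -1 := le_of_forall_pos_le_add fun δ hδ => csInf_le (hbdd _) (by
      change (-1 + δ) • a - -a ∈ C
      convert C.smul_mem hδ ha using 1
      module)
    rw [map_neg] at h1
    linarith

/-! ### States on Archimedean effect modules -/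

namespace EffectModule

open EffectAlgebra EffectAlgebra.Extended
open scoped NNReal

variable {M : Type u} [EffectModule M]

/-- The scalar `r`, cut off to the unit interval. -/
noncomputable def clamp (r : ℝ) : I := Set.projIcc 0 1 zero_le_one r

theorem coe_clamp {r : ℝ} (h0 : 0 ≤ r) (h1 : r ≤ 1) : (clamp r : ℝ) = r :=
  congrArg Subtype.val (Set.projIcc_of_mem zero_le_one (⟨h0, h1⟩ : r ∈ Set.Icc (0 : ℝ) 1))

theorem clamp_zero : clamp 0 = 0 := Set.projIcc_left zero_le_one

theorem eventually_mul_mem_Icc (c : ℝ≥0) : ∀ᶠ t : ℝ in 𝓝[>] 0, 0 ≤ t * c ∧ t * c ≤ 1 := by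
  have h : Tendsto (fun t : ℝ => t * c) (𝓝[>] 0) (𝓝 0) := by
    have : Tendsto (fun t : ℝ => t * c) (𝓝 0) (𝓝 (0 * c)) :=
        tendsto_id.mul_const _
    rw [zero_mul] at this
    exact this.mono_left nhdsWithin_le_nhds
  filter_upwards [h (Iic_mem_nhds one_pos), self_mem_nhdsWithin] with t ht ht0
  exact ⟨mul_nonneg (le_of_lt ht0) c.2, ht⟩

/-- The germ at `0⁺` of `t ↦ (t c) x`. It stands for the multiple `c x`, which need not exist in
`M` when `c > 1`. -/
noncomputable def ray (x : M) : ℝ≥0 →+ Germ (𝓝[>] (0 : ℝ)) (Extended M) where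
  toFun c := ((fun t : ℝ => of (scale (clamp (t * c)) x) : ℝ → Extended M) : Germ _ _)
  map_zero' := by
    have : (fun t : ℝ => of (scale (clamp (t * (0 : ℝ≥0))) x)) = 0 := funext fun t => by
      rw [NNReal.coe_zero, mul_zero, clamp_zero, zero_scale]
      rfl
    rw [this]
    rfl
  map_add' c d := by
    rw [← Germ.coe_add, Germ.coe_eq]
    filter_upwards [eventually_mul_mem_Icc c, eventually_mul_mem_Icc d,
      eventually_mul_mem_Icc (c + d)] with t hc hd hcd
    refine (of_scale_add ?_ x).symm
    rw [coe_clamp hc.1 hc.2, coe_clamp hd.1 hd.2, coe_clamp hcd.1 hcd.2]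
    push_cast
    ring

theorem ray_apply (x : M) (c : ℝ≥0) : ray x c =
    ((fun t : ℝ => of (scale (clamp (t * c)) x) : ℝ → Extended M) : Germ _ _) := rfl

/-- The value of a formal positive combination of elements, as a germ at `0⁺`: the germ of
`t ↦ ∑ₓ (t αₓ) x`, where these sums exist for small `t`. -/
noncomputable def interp : (M →₀ ℝ≥0) →+ Germ (𝓝[>] (0 : ℝ)) (Extended M) :=
  Finsupp.liftAddHom ray

theorem interp_single (x : M) (c : ℝ≥0) : interp (Finsupp.single x c) = ray x c :=
  Finsupp.liftAddHom_apply_single _ _ _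

/-- The function of which `interp α` is the germ. -/
noncomputable def interpFun (α : M →₀ ℝ≥0) (t : ℝ) : Extended M :=
  α.sum fun x c => of (scale (clamp (t * c)) x)

theorem interp_eq_coe (α : M →₀ ℝ≥0) :
    interp α = (interpFun α : Germ (𝓝[>] (0 : ℝ)) (Extended M)) := by
  have : interpFun α = ∑ x ∈ α.support, fun t : ℝ => of (scale (clamp (t * α x)) x) := by
    ext t
    rw [Finset.sum_apply]
    rfl
  rw [this]
  exact (map_sum (Germ.coeAddHom (M := Extended M) (𝓝[>] (0 : ℝ))) _ _).symm

theorem interp_smul {c : ℝ≥0} (hc : 0 < c) {α β : M →₀ ℝ≥0} (h : interp α = interp β) :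
    interp (c • α) = interp (c • β) := by
  have key : ∀ (α : M →₀ ℝ≥0) (t : ℝ), interpFun (c • α) t = interpFun α (t * c) := by
    intro α t
    unfold interpFun
    rw [Finsupp.sum_smul_index]
    · simp only [NNReal.coe_mul, mul_assoc]
    · intro x
      rw [NNReal.coe_zero, mul_zero, clamp_zero, zero_scale]
      rfl
  rw [interp_eq_coe, interp_eq_coe, Germ.coe_eq] at h ⊢
  have ht : Tendsto (fun t : ℝ => t * c) (𝓝[>] 0) (𝓝[>] 0) := by
    refine tendsto_nhdsWithin_iff.2 ⟨?_, ?_⟩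
    · have : Tendsto (fun t : ℝ => t * c) (𝓝 0) (𝓝 (0 * c)) :=
        tendsto_id.mul_const _
      rw [zero_mul] at this
      exact this.mono_left nhdsWithin_le_nhds
    · filter_upwards [self_mem_nhdsWithin] with t ht
      exact mul_pos (Set.mem_Ioi.1 ht) (NNReal.coe_pos.2 hc)
  filter_upwards [ht.eventually h] with t h
  rw [key, key, h]

theorem interp_single_add {x y z : M} (h : of x + of y = of z) (c : ℝ≥0) :
    interp (Finsupp.single x c + Finsupp.single y c) = interp (Finsupp.single z c) := by
  simp only [map_add, interp_single, ray_apply]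
  rw [← Germ.coe_add]
  exact congrArg _ (funext fun t => of_scale_oplus _ h)

theorem interp_single_scale (r : I) (x : M) :
    interp (Finsupp.single (scale r x) 1) =
      interp (Finsupp.single x (unitInterval.toNNReal r)) := by
  simp only [interp_single, ray_apply]
  rw [Germ.coe_eq]
  filter_upwards [eventually_mul_mem_Icc 1,
    eventually_mul_mem_Icc (unitInterval.toNNReal r)] with t h1 h2
  have e : clamp (t * unitInterval.toNNReal r) = clamp (t * (1 : ℝ≥0)) * r := by
    apply Subtype.ext
    rw [Set.Icc.coe_mul, coe_clamp h1.1 h1.2, coe_clamp h2.1 h2.2]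
    simp
  rw [e, mul_scale]

/-- The sums that `interp α` consists of are parts of multiples of `1`. -/
theorem exists_interp_add (α : M →₀ ℝ≥0) :
    ∃ c g, interp α + g = interp (Finsupp.single one c) := by
  induction α using Finsupp.induction_linear with
  | zero => exact ⟨0, 0, by simp⟩
  | add α β hα hβ =>
    obtain ⟨c, g, h⟩ := hα
    obtain ⟨d, g', h'⟩ := hβ
    exact ⟨c + d, g + g', by rw [map_add, Finsupp.single_add, map_add, ← h, ← h', add_add_add_comm]⟩
  | single x c =>
    exact ⟨c, interp (Finsupp.single (compl x) c), by
      rw [← map_add, interp_single_add (of_add_compl x)]⟩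

/-- The values of formal combinations cancel. -/
theorem interp_cancel {α β γ : M →₀ ℝ≥0} (h : interp (α + γ) = interp (β + γ)) :
    interp α = interp β := by
  obtain ⟨c, g, hg⟩ := exists_interp_add (α + γ)
  simp only [map_add, interp_single, interp_eq_coe α, interp_eq_coe β, interp_eq_coe γ] at h hg ⊢
  induction g using Germ.inductionOn with
  | h g =>
    rw [ray_apply] at hg
    simp only [← Germ.coe_add, Germ.coe_eq] at h hg ⊢
    filter_upwards [h, hg] with t h hg
    simp only [Pi.add_apply] at h hg
    obtain ⟨z, hz⟩ := exists_of_left hg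
    exact add_right_cancel_of h hz

theorem nsmul_of_scale (n : ℕ) {r s : I} (h : n * (r : ℝ) = s) (x : M) :
    n • of (scale r x) = of (scale s x) := by
  induction n generalizing s with
  | zero =>
    have : s = 0 := Subtype.ext (by rw [← h]; simp)
    rw [this, zero_scale, zero_smul]
    rfl
  | succ n ih =>
    have hn : 0 ≤ n * (r : ℝ) := mul_nonneg n.cast_nonneg r.2.1
    have e : n * (r : ℝ) + r = s := by
      rw [← h]
      push_cast
      ring
    rw [succ_nsmul, ih (s := ⟨n * r, hn, by linarith [r.2.1, s.2.2]⟩) rfl]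
    exact of_scale_add e x

/-- An inequality between values of formal combinations holds between the multiples by some small
`t = ½ / n`, and multiplication by `n` turns it into one between halves. -/
theorem leUpTo_of_interp {r : I} {x y : M} {γ : M →₀ ℝ≥0}
    (h : interp (γ + Finsupp.single x 1) =
      interp (Finsupp.single y 1 + Finsupp.single one (unitInterval.toNNReal r))) :
    LeUpTo r x y := by
  simp only [map_add, interp_single, ray_apply, interp_eq_coe γ] at h
  rw [← Germ.coe_add, ← Germ.coe_add, Germ.coe_eq] at h
  have hlim : Tendsto (fun n : ℕ => 1 / 2 * (1 / ((n : ℝ) + 1))) atTop (𝓝[>] 0) := by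
    refine tendsto_nhdsWithin_iff.2 ⟨?_, Eventually.of_forall fun n => ?_⟩
    · rw [← mul_zero (1 / 2 : ℝ)]
      exact (tendsto_one_div_add_atTop_nhds_zero_nat (𝕜 := ℝ)).const_mul (1 / 2)
    · exact Set.mem_Ioi.2 (by positivity)
  obtain ⟨n, hn, h1, h2⟩ := (hlim.eventually (h.and ((eventually_mul_mem_Icc 1).and
    (eventually_mul_mem_Icc (unitInterval.toNNReal r))))).exists
  simp only [Pi.add_apply] at hn
  -- multiply the inequality at `t = ½ / (n + 1)` by `n + 1`
  have e1 : ((n + 1 : ℕ) : ℝ) * clamp (1 / 2 * (1 / ((n : ℝ) + 1)) * (1 : ℝ≥0)) = half := by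
    rw [coe_clamp h1.1 h1.2, coe_half]
    push_cast
    field_simp
  have e2 : ((n + 1 : ℕ) : ℝ) * clamp (1 / 2 * (1 / ((n : ℝ) + 1)) * unitInterval.toNNReal r) =
      (half * r : I) := by
    rw [coe_clamp h2.1 h2.2, Set.Icc.coe_mul, coe_half, unitInterval.coe_toNNReal]
    push_cast
    field_simp
  have o : Orth (scale half y) (scale (half * r) one) := orth_scale (by
    rw [Set.Icc.coe_mul, coe_half]
    linarith [r.2.2]) _ _
  have := congrArg ((n + 1) • ·) hn
  simp only [smul_add, nsmul_of_scale _ e1, nsmul_of_scale _ e2] at this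
  refine ⟨o, le_iff.2 ⟨(n + 1) • interpFun γ (1 / 2 * (1 / ((n : ℝ) + 1))), ?_⟩⟩
  rw [← of_oplus o, add_comm]
  exact this

/-- Formal positive combinations as formal linear combinations. -/
noncomputable def toRealComb {X : Type u} : (X →₀ ℝ≥0) →+ (X →₀ ℝ) :=
  Finsupp.mapRange.addMonoidHom NNReal.toRealHom.toAddMonoidHom

theorem toRealComb_single {X : Type u} (x : X) (c : ℝ≥0) :
    toRealComb (Finsupp.single x c) = Finsupp.single x (c : ℝ) := by
  simp [toRealComb]

theorem toRealComb_injective {X : Type u} : Function.Injective (toRealComb (X := X)) :=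
  Finsupp.mapRange_injective _ rfl NNReal.coe_injective

theorem toRealComb_smul {X : Type u} (c : ℝ≥0) (α : X →₀ ℝ≥0) :
    toRealComb (c • α) = (c : ℝ) • toRealComb α := by
  ext x
  simp [toRealComb]

/-- The formal linear combinations of elements of `M` that have to be nonnegative: up to
differences of formal positive combinations of equal value, their coefficients are nonnegative. -/
noncomputable def combCone (M : Type u) [EffectModule M] : ConvexCone ℝ (M →₀ ℝ) where
  carrier := {φ | ∃ γ α β : M →₀ ℝ≥0, interp α = interp β ∧
    φ = toRealComb γ + (toRealComb α - toRealComb β)}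
  smul_mem' := by
    rintro c hc _ ⟨γ, α, β, h, rfl⟩
    lift c to ℝ≥0 using hc.le
    refine ⟨c • γ, c • α, c • β, interp_smul (by exact_mod_cast hc) h, ?_⟩
    simp only [toRealComb_smul, smul_add, smul_sub]
  add_mem' := by
    rintro _ ⟨γ, α, β, h, rfl⟩ _ ⟨γ', α', β', h', rfl⟩
    refine ⟨γ + γ', α + α', β + β', by rw [map_add, map_add, h, h'], ?_⟩
    simp only [map_add]
    abel

theorem toRealComb_mem (γ : M →₀ ℝ≥0) : toRealComb γ ∈ combCone M := ⟨γ, 0, 0, rfl, by simp⟩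

theorem toRealComb_sub_mem {α β : M →₀ ℝ≥0} (h : interp α = interp β) :
    toRealComb α - toRealComb β ∈ combCone M := ⟨0, α, β, h, by simp⟩

/-- The element `1` is an order unit for the cone of formal combinations. -/
theorem exists_smul_one_add_mem (φ : M →₀ ℝ) :
    ∃ t : ℝ, t • toRealComb (Finsupp.single one 1) + φ ∈ combCone M := by
  induction φ using Finsupp.induction_linear with
  | zero => exact ⟨1, by simpa using toRealComb_mem _⟩
  | add φ ψ hφ hψ =>
    obtain ⟨s, hs⟩ := hφ
    obtain ⟨t, ht⟩ := hψ
    refine ⟨s + t, ?_⟩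
    convert (combCone M).add_mem hs ht using 1
    rw [add_smul]
    abel
  | single x c =>
    rcases le_total 0 c with hc | hc
    · lift c to ℝ≥0 using hc
      refine ⟨0, ?_⟩
      rw [zero_smul, zero_add, ← toRealComb_single]
      exact toRealComb_mem _
    · obtain ⟨d, rfl⟩ : ∃ d : ℝ≥0, c = -d := ⟨(-c).toNNReal, by
        rw [Real.coe_toNNReal _ (neg_nonneg.2 hc), neg_neg]⟩
      refine ⟨d, Finsupp.single (compl x) d, Finsupp.single one d,
        Finsupp.single x d + Finsupp.single (compl x) d,
        (interp_single_add (of_add_compl x) d).symm, ?_⟩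
      rw [← toRealComb_smul, map_add]
      simp only [toRealComb_single, Finsupp.smul_single, smul_eq_mul, mul_one, Finsupp.single_neg]
      abel

/-- The state given by a positive functional on the formal linear combinations. -/
noncomputable def stateOfFunctional (f : (M →₀ ℝ) →ₗ[ℝ] ℝ) (hf : ∀ φ ∈ combCone M, 0 ≤ f φ)
    (h1 : f (toRealComb (Finsupp.single one 1)) = 1) : Hom M I :=
  have hcongr : ∀ {α β : M →₀ ℝ≥0}, interp α = interp β → f (toRealComb α) = f (toRealComb β) := by
    intro α β h
    have e1 := hf _ (toRealComb_sub_mem h)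
    have e2 := hf _ (toRealComb_sub_mem h.symm)
    rw [map_sub] at e1 e2
    linarith
  have hadd : ∀ {x y z : M}, of x + of y = of z → f (toRealComb (Finsupp.single x 1)) +
      f (toRealComb (Finsupp.single y 1)) = f (toRealComb (Finsupp.single z 1)) := by
    intro x y z h
    rw [← map_add, ← map_add]
    exact hcongr (interp_single_add h 1)
  { toFun := fun x => ⟨f (toRealComb (Finsupp.single x 1)), hf _ (toRealComb_mem _), by
      have := hadd (of_add_compl x)
      rw [h1] at this
      linarith [hf _ (toRealComb_mem (Finsupp.single (compl x) 1))]⟩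
    map_scale := fun r x => Subtype.ext <| by
      change f _ = (r : ℝ) * f _
      rw [hcongr (interp_single_scale r x), ← smul_eq_mul, ← map_smul]
      congr 1
      simp [toRealComb_single]
    map_one := Subtype.ext (h1.trans coe_one.symm)
    map_oplus := fun x y h => by
      have e := hadd (of_oplus h)
      refine ⟨e.le.trans ?_, Subtype.ext e.symm⟩
      have e' := hadd (of_add_compl (oplus x y h))
      rw [h1] at e'
      linarith [hf _ (toRealComb_mem (Finsupp.single (compl (oplus x y h)) 1))] }

/-- The states of an Archimedean effect module determine its order. -/
theorem IsArchimedean.orderDetermining (hM : IsArchimedean M) :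
    OrderDetermining fun k : Hom M I => k := by
  intro x y h
  refine hM x y fun r hr => ?_
  by_contra hxy
  obtain ⟨f, hf, h1, hlt⟩ := (combCone M).exists_positive_functional
    (toRealComb_mem (Finsupp.single one 1)) exists_smul_one_add_mem
    (w := toRealComb (Finsupp.single y 1) - toRealComb (Finsupp.single x 1)) (ε := r) hr (by
      rintro ⟨γ, α, β, hαβ, e⟩
      apply hxy
      refine leUpTo_of_interp (γ := γ) (interp_cancel (γ := β) ?_)
      have e' : γ + Finsupp.single x 1 + α =
          Finsupp.single y 1 + Finsupp.single one (unitInterval.toNNReal r) + β := by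
        apply toRealComb_injective
        have e1 : toRealComb (Finsupp.single (one : M) (unitInterval.toNNReal r)) =
            (r : ℝ) • toRealComb (Finsupp.single one 1) := by
          simp [toRealComb_single]
        simp only [map_add, e1]
        rw [← sub_eq_zero] at e ⊢
        rw [← neg_eq_zero, ← e]
        abel
      rw [← e', map_add, map_add _ _ α, hαβ])
  have := h (stateOfFunctional f hf h1)
  rw [map_sub] at hlt
  change f _ ≤ f _ at this
  linarith

end EffectModule

/-! ### Approximation of states by finitely supported distributions -/

namespace EffectModule

open EffectAlgebra EffectAlgebra.Extended

variable {M : Type u} [EffectModule M]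

/-- A functional in the span of an order determining family that is nonnegative on the family is
nonnegative on all states. -/
theorem OrderDetermining.nonneg_of_mem_stateSpan {Y : Type v} {j : Y → Hom M I}
    (hj : OrderDetermining j) {s : Hom M I} {f : Option Y → ℝ}
    (hf : f ∈ stateSpan fun o : Option Y => o.elim s j) (h : ∀ y, 0 ≤ f (some y)) :
    0 ≤ f none := by
  obtain ⟨t, ht, x, hx⟩ := hf
  have hle : Le (scale half one) x := hj _ _ fun y => by
    have := hx (some y)
    simp only [Option.elim] at this
    rw [this, Hom.coe_map_scale, Hom.coe_map_one, coe_half]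
    nlinarith [h y]
  have h1 := s.mono hle
  have h2 := hx none
  simp only [Option.elim] at h2
  rw [h2, Hom.coe_map_scale, Hom.coe_map_one, coe_half] at h1
  by_contra! hneg
  nlinarith

/-- The values of finitely supported distributions at a fixed family of functions form a convex
set. -/
theorem convex_range_distribution {Y : Type v} {ι : Type*} (g : Y → ι → ℝ) :
    Convex ℝ (Set.range fun (φ : StdSimplex ℝ Y) (i : ι) =>
      φ.weights.sum fun y r => r * g y i) := by
  rintro _ ⟨φ, rfl⟩ _ ⟨ψ, rfl⟩ a b ha hb hab
  have key : ∀ h : Y → ℝ, ((a • φ.weights + b • ψ.weights).sum fun y r => r * h y) =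
      a * (φ.weights.sum fun y r => r * h y) + b * ψ.weights.sum fun y r => r * h y := by
    intro h
    have := (Finsupp.linearCombination ℝ h).map_add (a • φ.weights) (b • ψ.weights)
    rw [map_smul, map_smul] at this
    exact this
  refine ⟨⟨a • φ.weights + b • ψ.weights, add_nonneg (smul_nonneg ha φ.nonneg)
    (smul_nonneg hb ψ.nonneg), ?_⟩, ?_⟩
  · have h1 := key 1
    simp only [Pi.one_apply, mul_one] at h1
    rw [h1, φ.total, ψ.total, mul_one, mul_one, hab]
  · ext i
    exact key fun y => g y i

/-- On finitely many elements, a state is approximated by finite convex combinations of an order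
determining family: a separating functional would be a combination of elements that is nonnegative
on the family and negative at the state. -/
theorem OrderDetermining.mem_closure {Y : Type v} {j : Y → Hom M I} (hj : OrderDetermining j)
    (s : Hom M I) (A : Finset M) :
    (fun a : A => (s a : ℝ)) ∈ closure (Set.range fun (φ : StdSimplex ℝ Y) (a : A) =>
      φ.weights.sum fun y r => r * (j y a : ℝ)) := by
  classical
  by_contra hs
  obtain ⟨f, c, hlt, hle⟩ := geometric_hahn_banach_point_closed
    (convex_range_distribution fun (y : Y) (a : A) => (j y a : ℝ)).closure isClosed_closure hs
  have hf : ∀ v : A → ℝ, f v = ∑ a, f (Pi.single a 1) * v a := fun v => by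
    have := LinearMap.pi_apply_eq_sum_univ f.toLinearMap v
    simp only [ContinuousLinearMap.coe_coe, smul_eq_mul] at this
    rw [this]
    refine Finset.sum_congr rfl fun a _ => ?_
    rw [mul_comm]
    congr 2
    ext b
    simp [Pi.single_apply, eq_comm]
  have hmem : (fun o : Option Y => (∑ a : A, f (Pi.single a 1) * ((o.elim s j : Hom M I) a : ℝ)) +
      -c) ∈ stateSpan fun o : Option Y => o.elim s j := by
    refine Submodule.add_mem _ ?_ (const_mem_stateSpan _ (-c))
    have : (fun o : Option Y => ∑ a : A, f (Pi.single a 1) * ((o.elim s j : Hom M I) a : ℝ)) =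
        ∑ a : A, f (Pi.single a 1) • fun o : Option Y => ((o.elim s j : Hom M I) a : ℝ) := by
      ext o
      simp
    rw [this]
    exact Submodule.sum_mem _ fun a _ => Submodule.smul_mem _ _ (mem_stateSpan _ _)
  have h0 := hj.nonneg_of_mem_stateSpan hmem fun y => by
    have h1 := hle (fun a : A => (j y a : ℝ))
      (subset_closure ⟨StdSimplex.single y, funext fun a => by simp⟩)
    rw [hf] at h1
    simp only [Option.elim]
    linarith
  rw [hf] at hlt
  simp only [Option.elim] at h0
  linarith

/-- If a family of states determines the order, each state is the limit, along some ultrafilter,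
of the finite convex combinations of the family. -/
theorem OrderDetermining.exists_ultrafilter {Y : Type v} {j : Y → Hom M I}
    (hj : OrderDetermining j) (s : Hom M I) :
    ∃ F : Ultrafilter (StdSimplex ℝ Y), ∀ a : M,
      Tendsto (fun φ : StdSimplex ℝ Y => φ.weights.sum fun y r => r * (j y a : ℝ)) F
        (𝓝 (s a : ℝ)) := by
  let Φ : StdSimplex ℝ Y → M → ℝ := fun φ a => φ.weights.sum fun y r => r * (j y a : ℝ)
  have hne : (comap Φ (𝓝 fun a => (s a : ℝ))).NeBot := by
    rw [comap_neBot_iff]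
    intro U hU
    rw [nhds_pi, Filter.mem_pi'] at hU
    obtain ⟨A, t, ht, hU⟩ := hU
    obtain ⟨_, hv, φ, rfl⟩ := mem_closure_iff_nhds.1 (hj.mem_closure s A)
      (Set.univ.pi fun a : A => t a) (set_pi_mem_nhds Set.finite_univ fun a _ => ht a)
    exact ⟨φ, hU fun a ha => hv ⟨a, ha⟩ trivial⟩
  refine ⟨Ultrafilter.of (comap Φ (𝓝 fun a => (s a : ℝ))), fun a => ?_⟩
  have h : Tendsto Φ (comap Φ (𝓝 fun a => (s a : ℝ))) (𝓝 fun a => (s a : ℝ)) := tendsto_comap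
  exact ((continuous_apply a).tendsto _).comp (h.mono_left (Ultrafilter.of_le _))

theorem unitInterval_le_iff {r s : I} : Le r s ↔ (r : ℝ) ≤ s := by
  constructor
  · rintro ⟨t, h, rfl⟩
    exact le_add_of_nonneg_right t.2.1
  · intro h
    exact ⟨⟨s - r, sub_nonneg.2 h, by linarith [r.2.1, s.2.2]⟩,
      (add_sub_cancel (r : ℝ) s).le.trans s.2.2, Subtype.ext (add_sub_cancel (r : ℝ) s)⟩

end EffectModule

namespace Expectation

open EffectModule EffectAlgebra

theorem orderDetermining_unit (X : Type u) :
    OrderDetermining fun x : X => (unit x : Expectation X) := by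
  intro p q h
  choose z o e using fun x => unitInterval_le_iff.2 (h x)
  exact ⟨z, o, funext e⟩

/-- Each expectation is a limit of finitely supported distributions. -/
theorem exists_ultraLim_ofDistribution {X : Type u} (h : Expectation X) :
    ∃ F : Ultrafilter (StdSimplex ℝ X), ∀ p, ultraLim F (fun φ => ofDistribution φ p) = h p := by
  obtain ⟨F, hF⟩ := (orderDetermining_unit X).exists_ultrafilter h
  exact ⟨F, fun p => Subtype.ext (coe_ultraLim_eq (hF p))⟩

end Expectation

/-! ### Affine continuous functions on algebras of the expectation monad -/

namespace EAlg

open EffectModule EffectAlgebra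

variable (A : EAlg.{u})

theorem le_nhds_act (F : Ultrafilter A.A) : (F : Filter A.A) ≤ 𝓝 (A.act (.ofUltrafilter F)) :=
  Compactum.le_nhds_of_str_eq (X := A.toCompactum) F _ rfl

/-- The limit in `A`, along an ultrafilter, of finite convex combinations. -/
noncomputable def limComb (F : Ultrafilter (StdSimplex ℝ A.A)) : A.A :=
  A.act (.ofUltrafilter (F.map fun φ => A.act (.ofDistribution φ)))

theorem limComb_eq_act {F : Ultrafilter (StdSimplex ℝ A.A)} {h : Expectation A.A}
    (hF : ∀ p, Expectation.ultraLim F (fun φ => Expectation.ofDistribution φ p) = h p) :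
    A.limComb F = A.act h := by
  have e : h = Expectation.mult
      (Expectation.map Expectation.ofDistribution (Expectation.ofUltrafilter F)) :=
    Hom.ext fun p => (hF p).symm
  rw [e, A.act_mult]
  rfl

variable {A}

theorem sConvexComb_map {X : Type u} (f : X → ℝ) (φ : StdSimplex ℝ X) :
    Convexity.sConvexComb (φ.map f) = φ.weights.sum fun x r => r * f x := by
  rw [Convexity.sConvexComb_eq_sum, StdSimplex.weights_map,
    Finsupp.sum_mapDomain_index (by simp) (by intros; simp [add_mul])]
  rfl

theorem coe_affine_apply {X : CCH.{u}} {q : X.carrier → I} (hq : X.IsAffineContinuous q)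
    (φ : StdSimplex ℝ X.carrier) :
    q (ConvexSpace.sConvexComb φ) = Expectation.ofDistribution φ q := by
  apply Subtype.ext
  exact (hq.2.map_sConvexComb φ).trans (sConvexComb_map _ φ)

theorem apply_limComb {q : A.A → I} (hq : (toCCH.obj A).IsAffineContinuous q)
    (F : Ultrafilter (StdSimplex ℝ A.A)) :
    q (A.limComb F) = Expectation.ultraLim F fun φ => Expectation.ofDistribution φ q := by
  have h1 : Tendsto q (F.map fun φ => A.act (.ofDistribution φ)) (𝓝 (q (A.limComb F))) :=
    (hq.1.tendsto _).mono_left (A.le_nhds_act _)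
  have h2 := Expectation.ultraLim_eq h1
  rw [← h2]
  have : (fun φ => Expectation.ofDistribution φ q) = fun φ => q (A.act (.ofDistribution φ)) :=
    funext fun φ => (coe_affine_apply hq φ).symm
  rw [this]
  rfl

/-- Affine continuous functions are algebra maps, because each expectation is a limit of finitely
supported distributions. -/
theorem apply_act_of_affineContinuous {q : A.A → I} (hq : (toCCH.obj A).IsAffineContinuous q)
    (h : Expectation A.A) : q (A.act h) = h q := by
  obtain ⟨F, hF⟩ := h.exists_ultraLim_ofDistribution
  rw [← A.limComb_eq_act hF, apply_limComb hq, hF]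

namespace Predicate

theorem apply_act (q : Predicate A) (h : Expectation A.A) : q (A.act h) = h q := (q.2 h).symm

theorem isAffineContinuous (q : Predicate A) : (toCCH.obj A).IsAffineContinuous q := by
  constructor
  · refine continuous_iff_ultrafilter.2 fun (x : A.A) (g : Ultrafilter A.A) hg => ?_
    have hx : x = A.act (.ofUltrafilter g) := by
      exact tendsto_nhds_unique (f := id) (l := (g : Filter A.A)) hg (A.le_nhds_act g)
    rw [hx, q.apply_act]
    exact Expectation.tendsto_ultraLim g q
  · exact ⟨fun φ => (congrArg Subtype.val (q.apply_act (.ofDistribution φ))).trans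
      (sConvexComb_map _ φ).symm⟩

/-- The predicate given by an affine continuous function. -/
def ofAffineContinuous {q : A.A → I} (hq : (toCCH.obj A).IsAffineContinuous q) : Predicate A :=
  ⟨q, fun h => (apply_act_of_affineContinuous hq h).symm⟩

/-- Evaluation of predicates at a point, as a state. -/
def evalAt (x : A.A) : Hom (Predicate A) I := (evalState A).f x

theorem evalAt_apply (x : A.A) (q : Predicate A) : evalAt x q = q x := rfl

theorem orderDetermining_evalAt : OrderDetermining (evalAt (A := A)) := by
  intro p q h
  have o : Orth p (EffectAlgebra.compl q) := fun x => by
    have := h x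
    change (p x : ℝ) + (1 - q x) ≤ 1
    rw [evalAt_apply, evalAt_apply] at this
    linarith
  have := orth_iff_le_compl.1 o
  rwa [Extended.compl_compl] at this

end Predicate

theorem isObservable_iff : A.IsObservable ↔
    ∀ x x' : A.A, (∀ q : Predicate A, q x = q x') → x = x' :=
  ⟨fun h x x' hx => h x x' fun _ hq => hx (Predicate.ofAffineContinuous hq),
    fun h x x' hx => h x x' fun q => hx q q.isAffineContinuous⟩

/-- The states of the predicates on an algebra are evaluations at points. -/
theorem evalAt_surjective (A : EAlg.{u}) :
    Function.Surjective (Predicate.evalAt (A := A)) := by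
  intro s
  obtain ⟨F, hF⟩ := Predicate.orderDetermining_evalAt.exists_ultrafilter s
  refine ⟨A.limComb F, Hom.ext fun q => ?_⟩
  rw [Predicate.evalAt_apply, apply_limComb q.isAffineContinuous]
  exact Subtype.ext (Expectation.coe_ultraLim_eq (hF q))

theorem evalAt_injective (hA : A.IsObservable) :
    Function.Injective (Predicate.evalAt (A := A)) := fun x x' h =>
  isObservable_iff.1 hA x x' fun q => congrArg (fun k : Hom (Predicate A) I => k q) h

end EAlg

/-! ### The predicates on an algebra form a Banach effect module -/

namespace Expectation

open EffectModule

theorem apply_le_add {X : Type u} (h : Expectation X) {p q : X → I} {ε : ℝ} (hε : 0 ≤ ε)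
    (hpq : ∀ x, (p x : ℝ) ≤ q x + ε) : (h p : ℝ) ≤ h q + ε := by
  rcases le_total ε 1 with h1 | h1
  · exact ((orderDetermining_unit X).leUpTo (r := ⟨ε, hε, h1⟩) hpq).map_le h
  · linarith [(h p).2.2, (h q).2.1]

theorem abs_apply_sub_le {X : Type u} (h : Expectation X) {p q : X → I} {ε : ℝ} (hε : 0 ≤ ε)
    (hpq : ∀ x, |(p x : ℝ) - q x| ≤ ε) : |(h p : ℝ) - h q| ≤ ε := by
  have h1 := h.apply_le_add hε fun x => show (p x : ℝ) ≤ q x + ε by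
    linarith [(abs_le.1 (hpq x)).2]
  have h2 := h.apply_le_add hε fun x => show (q x : ℝ) ≤ p x + ε by
    linarith [(abs_le.1 (hpq x)).1]
  rw [abs_le]
  constructor <;> linarith

end Expectation

namespace EAlg

open EffectModule EffectAlgebra

/-- A uniform limit of predicates is a predicate, because expectations are nonexpansive for the
supremum distance. -/
theorem Predicate.isMetricComplete (A : EAlg.{u}) : IsMetricComplete (Predicate A) := by
  intro a ha
  have hunif : ∀ ε : ℝ, 0 < ε → ∃ N, ∀ m n, N ≤ m → N ≤ n →
      ∀ x : A.A, |(a m x : ℝ) - a n x| ≤ ε := fun ε hε => by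
    obtain ⟨N, hN⟩ := ha ε hε
    exact ⟨N, fun m n hm hn x => map_le_add_of_distance_lt (hN m n hm hn) (evalAt x)⟩
  have hcauchy : ∀ x : A.A, CauchySeq fun n => a n x := fun x => by
    refine Metric.cauchySeq_iff.2 fun ε hε => ?_
    obtain ⟨N, hN⟩ := hunif (ε / 2) (half_pos hε)
    exact ⟨N, fun m hm n hn => (hN m n hm hn x).trans_lt (half_lt_self hε)⟩
  choose q hq using fun x => cauchySeq_tendsto_of_complete (hcauchy x)
  have hlim : ∀ ε : ℝ, 0 < ε → ∃ N, ∀ n, N ≤ n → ∀ x : A.A, |(a n x : ℝ) - q x| ≤ ε :=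
    fun ε hε => by
      obtain ⟨N, hN⟩ := hunif ε hε
      refine ⟨N, fun n hn x => le_of_tendsto
        (((continuous_subtype_val.tendsto _).comp (hq x)).const_sub _).abs ?_⟩
      filter_upwards [eventually_ge_atTop N] with m hm
      exact hN n m hn hm x
  have hpred : ∀ h : Expectation A.A, h q = q (A.act h) := fun h => by
    refine tendsto_nhds_unique (f := fun n => a n (A.act h)) (l := atTop) ?_ (hq _)
    refine Metric.tendsto_atTop.2 fun ε hε => ?_
    obtain ⟨N, hN⟩ := hlim (ε / 2) (half_pos hε)
    refine ⟨N, fun n hn => ?_⟩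
    rw [(a n).apply_act]
    exact (h.abs_apply_sub_le (half_pos hε).le (hN n hn)).trans_lt (half_lt_self hε)
  refine ⟨⟨q, hpred⟩, fun ε hε => ?_⟩
  obtain ⟨N, hN⟩ := hlim (ε / 2) (half_pos hε)
  exact ⟨N, fun n hn =>
    (orderDetermining_evalAt.distance_le (half_pos hε) (hN n hn)).trans_lt (half_lt_self hε)⟩

theorem predicateModule_isBanach (A : EAlg.{u}) : (predicateModule A).IsBanach :=
  ⟨Predicate.orderDetermining_evalAt.isArchimedean, Predicate.isMetricComplete A⟩

end EAlg

theorem stateAlg_isObservable (M : EMod.{u}) : (stateAlg M).IsObservable :=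
  EAlg.isObservable_iff.2 fun _ _ h =>
    EffectModule.Hom.ext fun y => h ⟨fun k => EffectModule.Hom.toFun k y, fun _ => rfl⟩

/-! ### Expectations given by positive functionals -/

/-- The bounded real functions on a set. -/
def boundedFunctions (X : Type u) : Submodule ℝ (X → ℝ) where
  carrier := {f | ∃ c, ∀ x, |f x| ≤ c}
  zero_mem' := ⟨0, by simp⟩
  add_mem' := by
    rintro f g ⟨c, hc⟩ ⟨d, hd⟩
    exact ⟨c + d, fun x => (abs_add_le _ _).trans (add_le_add (hc x) (hd x))⟩
  smul_mem' := by
    rintro r f ⟨c, hc⟩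
    exact ⟨|r| * c, fun x => by
      rw [Pi.smul_apply, smul_eq_mul, abs_mul]
      exact mul_le_mul_of_nonneg_left (hc x) (abs_nonneg r)⟩

/-- A function into the unit interval as a bounded real function. -/
def boundedOfUnitInterval {X : Type u} (p : X → I) : boundedFunctions X :=
  ⟨fun x => p x, 1, fun x => by rw [abs_of_nonneg (p x).2.1]; exact (p x).2.2⟩

/-- The expectation given by a normalised positive functional on the bounded functions. -/
def Expectation.ofFunctional {X : Type u} (f : boundedFunctions X →ₗ[ℝ] ℝ)
    (hf : ∀ g : boundedFunctions X, (∀ x, 0 ≤ g.1 x) → 0 ≤ f g)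
    (h1 : f (boundedOfUnitInterval fun _ => 1) = 1) : Expectation X :=
  have hle : ∀ p : X → I, f (boundedOfUnitInterval p) ≤ 1 := fun p => by
    rw [← sub_nonneg, ← h1, ← map_sub]
    exact hf _ fun x => sub_nonneg.2 (p x).2.2
  { toFun := fun p => ⟨f (boundedOfUnitInterval p), hf _ fun x => (p x).2.1, hle p⟩
    map_scale := fun r p => Subtype.ext (f.map_smul (r : ℝ) (boundedOfUnitInterval p))
    map_one := Subtype.ext <|
      (congrArg f (Subtype.ext (funext fun _ => EffectModule.coe_one))).trans
        (h1.trans EffectModule.coe_one.symm)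
    map_oplus := fun p q h => by
      have e := f.map_add (boundedOfUnitInterval p) (boundedOfUnitInterval q)
      exact ⟨e.symm.le.trans (hle (oplus p q h)), Subtype.ext e⟩ }

/-! ### Predicates on the states of a Banach effect module -/

namespace EffectModule

open EffectAlgebra

/-- The pairs `(f, g)` of bounded functions with `v ≤ f` and `-v ≤ g` for some `v` in a given
space of functions. -/
def pairCone {X : Type u} (V : Submodule ℝ (X → ℝ)) :
    ConvexCone ℝ (boundedFunctions X × boundedFunctions X) where
  carrier := {p | ∃ v ∈ V, (∀ x, v x ≤ p.1.1 x) ∧ ∀ x, -v x ≤ p.2.1 x}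
  smul_mem' := by
    rintro c hc p ⟨v, hv, h1, h2⟩
    refine ⟨c • v, V.smul_mem c hv, fun x => mul_le_mul_of_nonneg_left (h1 x) hc.le, fun x => ?_⟩
    change -(c * v x) ≤ c * p.2.1 x
    rw [← mul_neg]
    exact mul_le_mul_of_nonneg_left (h2 x) hc.le
  add_mem' := by
    rintro p ⟨v, hv, h1, h2⟩ p' ⟨v', hv', h1', h2'⟩
    refine ⟨v + v', V.add_mem hv hv', fun x => add_le_add (h1 x) (h1' x), fun x => ?_⟩
    change -(v x + v' x) ≤ p.2.1 x + p'.2.1 x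
    linarith [h2 x, h2' x]

/-- A function that is not a uniform limit of functions in `V` is told apart from them by two
expectations that agree on `V`. -/
theorem exists_expectations {X : Type u} {V : Submodule ℝ (X → ℝ)} (hV : (fun _ => 1) ∈ V)
    {q : X → I} {ε : ℝ} (hε : 0 < ε) (hq : ∀ v ∈ V, ∃ x, ε < |(q x : ℝ) - v x|) :
    ∃ h h' : Expectation X, (∀ p : X → I, (fun x => (p x : ℝ)) ∈ V → h p = h' p) ∧ h q ≠ h' q := by
  let a : boundedFunctions X := boundedOfUnitInterval fun _ => 1
  let b : boundedFunctions X := boundedOfUnitInterval q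
  obtain ⟨f, hf, h1, hlt⟩ := (pairCone V).exists_positive_functional (a := (a, a)) (w := (-b, b))
    ⟨0, V.zero_mem, fun _ => zero_le_one, fun _ => by
      change -0 ≤ (1 : ℝ)
      norm_num⟩
    (by
      rintro ⟨⟨f, c, hc⟩, ⟨g, d, hd⟩⟩
      refine ⟨|c| + |d|, 0, V.zero_mem, fun x => ?_, fun x => ?_⟩
      · change 0 ≤ (|c| + |d|) * 1 + f x
        linarith [(abs_le.1 (hc x)).1, le_abs_self c, abs_nonneg d]
      · change -0 ≤ (|c| + |d|) * 1 + g x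
        linarith [(abs_le.1 (hd x)).1, le_abs_self d, abs_nonneg c])
    hε (by
      rintro ⟨v, hv, h1, h2⟩
      obtain ⟨x, hx⟩ := hq (-v) (V.neg_mem hv)
      have e1 : v x ≤ -(q x : ℝ) + ε * 1 := h1 x
      have e2 : -v x ≤ (q x : ℝ) + ε * 1 := h2 x
      refine hx.not_ge (abs_le.2 ?_)
      rw [Pi.neg_apply]
      constructor <;> linarith)
  have hagree : ∀ g : boundedFunctions X, g.1 ∈ V → f (g, 0) = f (0, g) := fun g hg => by
    have e1 := hf (g, -g) ⟨g.1, hg, fun _ => le_rfl, fun _ => le_rfl⟩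
    have e2 := hf (-g, g) ⟨-g.1, V.neg_mem hg, fun _ => le_rfl, fun x => (neg_neg (g.1 x)).le⟩
    have d1 : ((g, -g) : boundedFunctions X × boundedFunctions X) = (g, 0) - (0, g) := by simp
    have d2 : ((-g, g) : boundedFunctions X × boundedFunctions X) = (0, g) - (g, 0) := by simp
    rw [d1, map_sub] at e1
    rw [d2, map_sub] at e2
    linarith
  have ha := hagree a hV
  have hsum : f (a, 0) + f (0, a) = 1 := by
    rw [← map_add, ← h1]
    simp
  refine ⟨.ofFunctional ((2 : ℝ) • f ∘ₗ LinearMap.inl ℝ _ _) (fun g hg => ?_) ?_,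
    .ofFunctional ((2 : ℝ) • f ∘ₗ LinearMap.inr ℝ _ _) (fun g hg => ?_) ?_, fun p hp => ?_, ?_⟩
  · exact mul_nonneg two_pos.le (hf (g, 0) ⟨0, V.zero_mem, hg, fun _ => neg_zero.le⟩)
  · change 2 * f (a, 0) = 1
    linarith
  · refine mul_nonneg two_pos.le (hf (0, g) ⟨0, V.zero_mem, fun _ => le_rfl, fun x => ?_⟩)
    exact neg_zero.le.trans (hg x)
  · change 2 * f (0, a) = 1
    linarith
  · exact Subtype.ext (congrArg ((2 : ℝ) * ·) (hagree (boundedOfUnitInterval p) hp))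
  · intro h
    have h2 : 2 * f (b, 0) = 2 * f (0, b) := congrArg Subtype.val h
    have d : ((-b, b) : boundedFunctions X × boundedFunctions X) = (0, b) - (b, 0) := by simp
    rw [d, map_sub] at hlt
    linarith

/-- If a function `q` into the unit interval is within `ε` of the span of `M`, it is within `2 ε`
of an element of `M`. -/
theorem OrderDetermining.exists_near {M : Type u} [EffectModule M] {Z : Type v} {K : Z → Hom M I}
    (hK : OrderDetermining K) {q : Z → I} {ε : ℝ} (hε : 0 < ε) {v : Z → ℝ}
    (hv : v ∈ stateSpan K) (hqv : ∀ z, |(q z : ℝ) - v z| ≤ ε) :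
    ∃ x : M, ∀ z, |(K z x : ℝ) - q z| ≤ 2 * ε := by
  have hpos : 0 < 1 + 2 * ε := by positivity
  have hmem : (1 / (1 + 2 * ε)) • (v + fun _ => ε) ∈ stateSpan K :=
    Submodule.smul_mem _ _ (Submodule.add_mem _ hv (const_mem_stateSpan K ε))
  have happ : ∀ z, ((1 / (1 + 2 * ε)) • (v + fun _ => ε) : Z → ℝ) z =
      (v z + ε) / (1 + 2 * ε) := fun z => by
    rw [Pi.smul_apply, smul_eq_mul, Pi.add_apply]
    ring
  obtain ⟨x, hx⟩ := hK.exists_of_mem_stateSpan hmem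
    (fun z => by
      rw [happ]
      exact div_nonneg (by linarith [(abs_le.1 (hqv z)).2, (q z).2.1]) hpos.le)
    (fun z => by
      rw [happ, div_le_one hpos]
      linarith [(abs_le.1 (hqv z)).1, (q z).2.2])
  refine ⟨x, fun z => ?_⟩
  obtain ⟨h1, h2⟩ := abs_le.1 (hqv z)
  have q0 := (q z).2.1
  have q1 := (q z).2.2
  rw [hx, happ, abs_le, le_sub_iff_add_le, sub_le_iff_le_add, le_div_iff₀ hpos, div_le_iff₀ hpos]
  constructor <;> nlinarith

end EffectModule

namespace EMod

open EffectModule EffectAlgebra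

/-- The image of `M` is uniformly dense in the predicates on its states: two expectations that
agree on `M` have the same average state, so no predicate can tell them apart. -/
theorem exists_near_predicate {M : EMod.{u}} (hM : IsArchimedean M.carrier)
    (q : EAlg.Predicate (stateAlg M)) {ε : ℝ} (hε : 0 < ε) :
    ∃ x : M.carrier, ∀ k : Hom M.carrier I, |(k x : ℝ) - q.1 k| ≤ 2 * ε := by
  by_cases h : ∃ v ∈ stateSpan fun k : Hom M.carrier I => k,
      ∀ k : Hom M.carrier I, |(q.1 k : ℝ) - v k| ≤ ε
  · obtain ⟨v, hv, hqv⟩ := h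
    exact hM.orderDetermining.exists_near hε hv hqv
  · push Not at h
    obtain ⟨h₁, h₂, hagree, hne⟩ := exists_expectations (const_mem_stateSpan _ 1) hε h
    have hav : Expectation.average h₁ = Expectation.average h₂ :=
      Hom.ext fun y => hagree (fun k => k y) (mem_stateSpan _ y)
    refine absurd ?_ hne
    exact (q.2 h₁).trans ((congrArg q.1 hav).trans (q.2 h₂).symm)

theorem evalPredicate_surjective {M : EMod.{u}} (hM : M.IsBanach)
    (q : EAlg.Predicate (stateAlg M)) :
    ∃ x : M.carrier, ∀ k : Hom M.carrier I, k x = q.1 k := by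
  have hpos : ∀ n : ℕ, (0 : ℝ) < 1 / ((n : ℝ) + 1) := fun n => by positivity
  choose a ha using fun n : ℕ => exists_near_predicate hM.1 q (hpos n)
  have hsmall : ∀ ε : ℝ, 0 < ε → ∃ N, ∀ n, N ≤ n → ∀ k : Hom M.carrier I,
      |(k (a n) : ℝ) - q.1 k| ≤ ε := fun ε hε => by
    obtain ⟨N, hN⟩ := exists_nat_one_div_lt (half_pos hε)
    refine ⟨N, fun n hn k => (ha n k).trans ?_⟩
    have : 1 / ((n : ℝ) + 1) ≤ 1 / ((N : ℝ) + 1) := one_div_le_one_div_of_le (by positivity)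
      (by exact_mod_cast Nat.succ_le_succ hn)
    linarith
  obtain ⟨x, hx⟩ := hM.2 a fun ε hε => by
    obtain ⟨N, hN⟩ := hsmall (ε / 4) (by positivity)
    refine ⟨N, fun m n hm hn => lt_of_le_of_lt
      (hM.1.orderDetermining.distance_le (half_pos hε) fun k => ?_) (half_lt_self hε)⟩
    have h1 := abs_le.1 (hN m hm k)
    have h2 := abs_le.1 (hN n hn k)
    rw [abs_le]
    constructor <;> linarith
  refine ⟨x, fun k => Subtype.ext (eq_of_abs_sub_le_all fun ε hε => ?_)⟩
  obtain ⟨N, hN⟩ := hx (ε / 2) (half_pos hε)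
  obtain ⟨N', hN'⟩ := hsmall (ε / 2) (half_pos hε)
  have h1 := abs_le.1 (map_le_add_of_distance_lt (hN _ (le_max_left N N')) k)
  have h2 := abs_le.1 (hN' _ (le_max_right N N') k)
  rw [abs_le]
  constructor <;> linarith

end EMod

/-! ### The duality -/

namespace EffectModule.Hom

/-- The inverse of a bijective homomorphism that reflects the existence of sums. -/
noncomputable def inverse {E : Type u} {D : Type v} [EffectModule E] [EffectModule D]
    (f : Hom E D) (hf : Function.Bijective f)
    (horth : ∀ x y, Orth (f x) (f y) → Orth x y) : Hom D E :=
  have hr : ∀ y, f (Function.surjInv hf.2 y) = y := Function.surjInv_eq hf.2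
  { toFun := Function.surjInv hf.2
    map_scale := fun r y => hf.1 <| by
      rw [hr]
      exact ((f.map_scale r _).trans (congrArg (scale r) (hr y))).symm
    map_one := hf.1 ((hr _).trans f.map_one.symm)
    map_oplus := fun x y h => by
      have o : Orth (Function.surjInv hf.2 x) (Function.surjInv hf.2 y) :=
        horth _ _ (by rwa [hr, hr])
      refine ⟨o, hf.1 ((hr _).trans ?_)⟩
      obtain ⟨h', e⟩ := f.map_oplus _ _ o
      change _ = f.toFun _
      rw [e]
      congr 1
      · exact (hr x).symm
      · exact (hr y).symm }

end EffectModule.Hom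

theorem isIso_evalState {A : EAlg.{u}} (hA : A.IsObservable) : IsIso (evalState A) := by
  have : IsIso (expectationMonad.forget.map (evalState A)) :=
    (isIso_iff_bijective _).2 ⟨EAlg.evalAt_injective hA, EAlg.evalAt_surjective A⟩
  exact isIso_of_reflects_iso (evalState A) expectationMonad.forget

theorem isIso_evalPredicate {M : EMod.{u}} (hM : M.IsBanach) : IsIso (evalPredicate M) := by
  have hK := hM.1.orderDetermining
  let f : EffectModule.Hom M.carrier (EAlg.Predicate (stateAlg M)) := evalPredicate M
  have hf : ∀ y k, (f y).1 k = EffectModule.Hom.toFun k y := fun _ _ => rfl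
  have hb : Function.Bijective f := by
    refine ⟨fun x y h => hK.eq fun k => ?_, fun q => ?_⟩
    · exact congrArg (fun p : EAlg.Predicate (stateAlg M) => p.1 k) h
    · obtain ⟨x, hx⟩ := EMod.evalPredicate_surjective hM q
      exact ⟨x, Subtype.ext (funext hx)⟩
  let g := f.inverse hb fun x y h => hK.orth h
  have h1 : ∀ y, f (g y) = y := Function.surjInv_eq hb.2
  refine ⟨(g : EffectModule.Hom _ _), EffectModule.Hom.ext fun x => hb.1 (h1 (f x)),
    EffectModule.Hom.ext h1⟩

theorem CategoryTheory.Adjunction.toEquivalence_toAdjunction {C : Type*} [Category* C] {D : Type*}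
    [Category* D] {F : C ⥤ D} {G : D ⥤ C} (adj : F ⊣ G) [∀ X, IsIso (adj.unit.app X)]
    [∀ Y, IsIso (adj.counit.app Y)] :
    (adj.toEquivalence.toAdjunction.ofNatIsoLeft (Iso.refl F)).ofNatIsoRight (Iso.refl G) =
      adj := by
  apply Adjunction.ext
  ext A : 2
  simp [Adjunction.ofNatIsoLeft, Adjunction.ofNatIsoRight, Adjunction.toEquivalence,
    Equivalence.toAdjunction, Equivalence.unit]

theorem restrictedAdjunction_equivalence :
    ∃ (hP : ∀ A : EAlg.{u}, A.IsObservable → (predicateModule A).IsBanach)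
      (hS : ∀ M : EMod.{u}, M.IsBanach → (stateAlg M).IsObservable)
      (e : EAlgObs.{u} ≌ BEMod.{u}ᵒᵖ)
      (i : e.functor ≅ restrictedPredicates hP)
      (j : e.inverse ≅ restrictedStates hS),
      (e.toAdjunction.ofNatIsoLeft i).ofNatIsoRight j = restrictedAdjunction hP hS := by
  let hP : ∀ A : EAlg.{u}, A.IsObservable → (predicateModule A).IsBanach :=
    fun A _ => A.predicateModule_isBanach
  let hS : ∀ M : EMod.{u}, M.IsBanach → (stateAlg M).IsObservable :=
    fun M _ => stateAlg_isObservable M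
  have hunit : ∀ A, IsIso ((restrictedAdjunction hP hS).unit.app A) := fun A => by
    have : IsIso (EAlg.IsObservable.ι.map ((restrictedAdjunction hP hS).unit.app A)) :=
      isIso_evalState A.property
    exact isIso_of_reflects_iso _ EAlg.IsObservable.ι
  have hcounit : ∀ M, IsIso ((restrictedAdjunction hP hS).counit.app M) := fun M => by
    have : IsIso (EMod.IsBanach.ι.map ((restrictedAdjunction hP hS).counit.app M).unop) :=
      isIso_evalPredicate M.unop.property
    have : IsIso ((restrictedAdjunction hP hS).counit.app M).unop :=
      isIso_of_reflects_iso _ EMod.IsBanach.ι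
    exact (isIso_unop_iff _).1 this
  refine ⟨hP, hS, (restrictedAdjunction hP hS).toEquivalence, Iso.refl _, Iso.refl _, ?_⟩
  exact (restrictedAdjunction hP hS).toEquivalence_toAdjunction

/-! ### Barycenters in convex compact Hausdorff spaces -/

namespace CCH

open EffectModule

theorem exists_barycenter (X : CCH.{u}) (h : Expectation X.carrier) :
    ∃ x : X.carrier, ∀ q : X.carrier → I, X.IsAffineContinuous q → q x = h q := by
  obtain ⟨F, hF⟩ := h.exists_ultraLim_ofDistribution
  refine ⟨(F.map fun φ => ConvexSpace.sConvexComb φ).lim, fun q hq => ?_⟩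
  have h1 := Expectation.ultraLim_eq ((hq.1.tendsto _).mono_left
    (F.map fun φ : StdSimplex ℝ X.carrier => ConvexSpace.sConvexComb φ).le_nhds_lim)
  rw [← h1, ← hF]
  have : (fun φ => Expectation.ofDistribution φ q) = fun φ => q (ConvexSpace.sConvexComb φ) :=
    funext fun φ => (EAlg.coe_affine_apply hq φ).symm
  rw [this]
  rfl

/-- A point at which each affine continuous function `q` takes the value `h(q)`. It is unique if
`X` is observable. -/
noncomputable def barycenter (X : CCH.{u}) (h : Expectation X.carrier) : X.carrier :=
  (X.exists_barycenter h).choose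

theorem apply_barycenter {X : CCH.{u}} (h : Expectation X.carrier) {q : X.carrier → I}
    (hq : X.IsAffineContinuous q) : q (X.barycenter h) = h q :=
  (X.exists_barycenter h).choose_spec q hq

theorem barycenter_eq {X : CCH.{u}} (hX : X.IsObservable) {h : Expectation X.carrier}
    {x : X.carrier} (hx : ∀ q : X.carrier → I, X.IsAffineContinuous q → q x = h q) :
    X.barycenter h = x :=
  hX _ _ fun q hq => (apply_barycenter h hq).trans (hx q hq).symm

theorem barycenter_unit {X : CCH.{u}} (hX : X.IsObservable) (x : X.carrier) :
    X.barycenter (.unit x) = x := barycenter_eq hX fun _ _ => rfl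

theorem barycenter_mult {X : CCH.{u}} (hX : X.IsObservable)
    (h : Expectation (Expectation X.carrier)) :
    X.barycenter h.mult = X.barycenter (h.map X.barycenter) :=
  barycenter_eq hX fun q hq => by
    rw [apply_barycenter _ hq]
    exact congrArg h (funext fun k => apply_barycenter k hq)

theorem barycenter_ofUltrafilter {X : CCH.{u}} (hX : X.IsObservable) {F : Ultrafilter X.carrier}
    {x : X.carrier} (hF : (F : Filter X.carrier) ≤ 𝓝 x) :
    X.barycenter (.ofUltrafilter F) = x :=
  barycenter_eq hX fun _ hq => (Expectation.ultraLim_eq ((hq.1.tendsto x).mono_left hF)).symm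

theorem barycenter_ofDistribution {X : CCH.{u}} (hX : X.IsObservable)
    (φ : StdSimplex ℝ X.carrier) :
    X.barycenter (.ofDistribution φ) = ConvexSpace.sConvexComb φ :=
  barycenter_eq hX fun _ hq => EAlg.coe_affine_apply hq φ

theorem map_barycenter {X Y : CCH.{u}} (hY : Y.IsObservable) (f : X ⟶ Y)
    (h : Expectation X.carrier) :
    Y.barycenter (h.map f.toFun) = f.toFun (X.barycenter h) :=
  barycenter_eq hY fun q hq =>
    apply_barycenter (q := q ∘ f.toFun) h ⟨hq.1.comp f.continuous, hq.2.comp f.affine⟩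

/-- The barycenter algebra of an observable convex compact Hausdorff space. -/
noncomputable def barycenterAlg (X : CCH.{u}) (hX : X.IsObservable) : EAlg.{u} where
  A := X.carrier
  a := ↾X.barycenter
  unit := by
    ext x
    exact barycenter_unit hX x
  assoc := by
    ext h
    exact barycenter_mult hX h

theorem toCCH_barycenterAlg (X : CCH.{u}) (hX : X.IsObservable) :
    EAlg.toCCH.obj (X.barycenterAlg hX) = X := by
  have htop : EAlg.topology (X.barycenterAlg hX) = X.top := by
    refine TopologicalSpace.ext_isClosed fun s => ?_
    refine (EAlg.isClosed_iff _ s).trans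
      (Iff.trans ?_ (isClosed_iff_ultrafilter (X := X.carrier) (s := s)).symm)
    constructor
    · intro h x F hF hs
      rw [← barycenter_ofUltrafilter hX hF]
      exact h F hs
    · intro h (F : Ultrafilter X.carrier) hs
      have : (X.barycenterAlg hX).act (.ofUltrafilter F) = F.lim :=
        barycenter_ofUltrafilter hX F.le_nhds_lim
      rw [this]
      exact h F.lim F F.le_nhds_lim hs
  have hconv : EAlg.convexSpace (X.barycenterAlg hX) = X.convex := by
    have key : ∀ c d : ConvexSpace ℝ X.carrier, c.sConvexComb = d.sConvexComb → c = d := by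
      rintro ⟨_, _, _⟩ ⟨_, _, _⟩ rfl
      rfl
    exact key _ _ (funext fun φ => barycenter_ofDistribution hX φ)
  have key : ∀ {α : Type u} {t t' : TopologicalSpace α} {c c' : ConvexSpace ℝ α}
      (h1 : @CompactSpace α t) (h2 : @T2Space α t) (h1' : @CompactSpace α t')
      (h2' : @T2Space α t'), t = t' → c = c' →
      @CCH.mk α t h1 h2 c = @CCH.mk α t' h1' h2' c' := by
    rintro α t _ c _ _ _ _ _ rfl rfl
    rfl
  exact key _ _ _ _ htop hconv

end CCH

/-! ### The isomorphism of categories -/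

theorem EAlg.barycenterAlg_toCCH {A : EAlg.{u}} (hA : A.IsObservable) :
    (EAlg.toCCH.obj A).barycenterAlg hA = A := by
  have key : ∀ {T : Type u} {a a' : expectationMonad.{u}.obj T ⟶ T} (h1 h2 h1' h2'), a = a' →
      (⟨T, a, h1, h2⟩ : EAlg.{u}) = ⟨T, a', h1', h2'⟩ := by
    rintro T a _ _ _ _ _ rfl
    rfl
  refine key (a := ↾(EAlg.toCCH.obj A).barycenter) (a' := A.a) _ _ A.unit A.assoc ?_
  ext h
  exact CCH.barycenter_eq hA fun q hq => EAlg.apply_act_of_affineContinuous hq h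

/-- The functor that equips observable convex compact Hausdorff spaces with their barycenter
algebra structures. -/
noncomputable def CCHObs.toEAlgObs : CCHObs.{u} ⥤ EAlgObs.{u} where
  obj X := ⟨X.obj.barycenterAlg X.property, by
    change CCH.IsObservable (EAlg.toCCH.obj _)
    rw [CCH.toCCH_barycenterAlg]
    exact X.property⟩
  map {X Y} f := ObjectProperty.homMk
    { f := ↾f.hom.toFun
      h := by
        ext h
        exact CCH.map_barycenter Y.property f.hom h }

theorem CCHObs.hom_heq {X X' Y Y' : CCHObs.{u}} (hX : X = X') (hY : Y = Y') (f : X ⟶ Y)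
    (f' : X' ⟶ Y') (h : HEq f.hom.toFun f'.hom.toFun) : HEq f f' := by
  subst hX hY
  exact heq_of_eq (ObjectProperty.hom_ext _ (CCH.Hom.ext (eq_of_heq h)))

theorem EAlgObs.hom_heq {A A' B B' : EAlgObs.{u}} (hA : A = A') (hB : B = B') (f : A ⟶ B)
    (f' : A' ⟶ B') (h : HEq f.hom.f f'.hom.f) : HEq f f' := by
  subst hA hB
  exact heq_of_eq (ObjectProperty.hom_ext _ (Monad.Algebra.Hom.ext (eq_of_heq h)))

theorem CCHObs.toEAlgObs_toCCHObs : CCHObs.toEAlgObs ⋙ EAlgObs.toCCHObs = 𝟭 CCHObs.{u} := by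
  have hobj : ∀ X : CCHObs.{u}, (CCHObs.toEAlgObs ⋙ EAlgObs.toCCHObs).obj X = X := fun X =>
    ObjectProperty.FullSubcategory.ext (X.obj.toCCH_barycenterAlg X.property)
  exact Functor.hext hobj fun X Y f => CCHObs.hom_heq (hobj X) (hobj Y) _ _ HEq.rfl

theorem EAlgObs.toCCHObs_toEAlgObs : EAlgObs.toCCHObs ⋙ CCHObs.toEAlgObs = 𝟭 EAlgObs.{u} := by
  have hobj : ∀ A : EAlgObs.{u}, (EAlgObs.toCCHObs ⋙ CCHObs.toEAlgObs).obj A = A := fun A =>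
    ObjectProperty.FullSubcategory.ext (EAlg.barycenterAlg_toCCH A.property)
  exact Functor.hext hobj fun A B f => EAlgObs.hom_heq (hobj A) (hobj B) _ _ HEq.rfl

theorem theorem8p6 :
    (∃ (hP : ∀ A : EAlg.{u}, A.IsObservable → (predicateModule A).IsBanach)
        (hS : ∀ M : EMod.{u}, M.IsBanach → (stateAlg M).IsObservable)
        (e : EAlgObs.{u} ≌ BEMod.{u}ᵒᵖ)
        (i : e.functor ≅ restrictedPredicates hP)
        (j : e.inverse ≅ restrictedStates hS),
        (e.toAdjunction.ofNatIsoLeft i).ofNatIsoRight j = restrictedAdjunction hP hS) ∧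
      ∃ G : CCHObs.{u} ⥤ EAlgObs.{u},
        G ⋙ EAlgObs.toCCHObs = 𝟭 CCHObs.{u} ∧ EAlgObs.toCCHObs ⋙ G = 𝟭 EAlgObs.{u} :=
  ⟨restrictedAdjunction_equivalence, CCHObs.toEAlgObs, CCHObs.toEAlgObs_toCCHObs,
    EAlgObs.toCCHObs_toEAlgObs⟩
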